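/- Let $X$ be a nonsingular projective curve with finite field of constants $\mathbf{F}_q$, let $\infty$ be a closed point of $X$, and let $\mathbf{A}=\Gamma(X\setminus\{\infty\},\mathcal{O}_X)$. For $0\neq a\in\mathbf{A}$ put $\deg a=\dim_{\mathbf{F}_q}\mathbf{A}/(a)$. Let $\gamma:S\to\operatorname{Spec}\mathbf{A}$ be a connected, locally noetherian $\mathbf{A}$-scheme, with induced ring morphism $\gamma^\sharp:\mathbf{A}\to\Gamma(S,\mathcal{O}_S)$. For an invertible sheaf $\mathcal{L}$ on $S$ let $\mathbf{G}_{a,\mathcal{L}}$ be the line bundle over $S$ representing $(f:T\to S)\mapsto H^0(T,f^*\mathcal{L})$; it is a group scheme with an action of $\mathbf{F}_q$. A Drinfeld module of rank $r>0$ over $S$ is a pair $\mathcal{E}=(\mathcal{L},\phi)$ of an invertible sheaf $\mathcal{L}$ and an $\mathbf{F}_q$-linear ring morphism $\phi:\mathbf{A}\to\operatorname{End}_{\mathbf{F}_q}(\mathbf{G}_{a,\mathcal{L}})$, $a\mapsto\phi_a$, such that for every non-zero $a\in\mathbf{A}$ the derivative of $\phi_a$ at $0$ (the coefficient $x_0$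 when $\phi_a$ is written locally as $x_0X+x_1X^q+x_2X^{q^2}+\cdots$) is $\gamma^\sharp(a)$, and $\phi_a$ is finite and flat of rank $q^{r\deg a}$. An isogeny of Drinfeld modules is a finite morphism of group schemes over $S$ compatible with the actions of $\mathbf{A}$. Let $\mathcal{E}=(\mathcal{L},\phi)$ be a Drinfeld module of rank $r$ over $S$, and let $G\subset\mathbf{G}_{a,\mathcal{L}}$ be a closed $\mathbf{A}$-invariant subgroup scheme, finite and flat over $S$. Over an affine open $U=\operatorname{Spec}R$ of $S$ on which $\mathcal{L}$ is trivialized, $G$ is the zero locus in $\mathbf{G}_{a,R}=\operatorname{Spec}R[X]$ of a unique monic polynomial $P$, which describes the quotient morphism by $G$ over $U$; let $x_i$ be the coefficient of $X^{q^i}$ in $P$. Suppose that $G$ has height $h$: $h$ is the smallest index for which $x_h$ is non-zero (that is, non-zero for some such $U$ and trivialization). Suppose moreover that $x_h$ is not a zero divisor, i.e. that for every such $U$ and trivialization it is not a zero divisor in $R$ (this is automatic if $S$ is integral). Then there exist a Drinfeld module $\mathcal{F}$ of rank $r$ over $S$ and an isogeny $\xi:\mathcal{E}\to\mathcal{F}$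 with kernel $G$ if and only if $$\gamma^\sharp(a^{q^h})=\gamma^\sharp(a)\qquad\text{for all } a\in\mathbf{A}.$$ -/

import Mathlib

open CategoryTheory AlgebraicGeometry

universe u

/-! Line bundles over a scheme -/

/-- A (geometric) line bundle `𝔾_{a,𝓛}` over `S`, given through its functor of points on `Sch/S`:
an `S`-scheme `total` such that `T ↦ Hom_S(T, total)` is a functor in modules over
`T ↦ Γ(T, 𝒪_T)` which, locally on `S`, is free of rank one on one generator
(so that `T ↦ Hom_S(T, total)` is `T ↦ Γ(T, f^* 𝓛)` for an invertible sheaf `𝓛`). -/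
structure LineBundle (S : Scheme.{u}) where
  /-- the underlying `S`-scheme -/
  total : Over S
  addCommGroup : ∀ T : Over S, AddCommGroup (T ⟶ total)
  module : ∀ T : Over S, Module Γ(T.left, ⊤) (T ⟶ total)
  comp_add : ∀ {T T' : Over S} (g : T' ⟶ T) (x y : T ⟶ total),
    g ≫ (x + y) = g ≫ x + g ≫ y
  comp_smul : ∀ {T T' : Over S} (g : T' ⟶ T) (c : Γ(T.left, ⊤)) (x : T ⟶ total),
    g ≫ (c • x) = (g.left.appTop.hom c) • (g ≫ x)
  exists_frame : ∀ s : S, ∃ U : S.Opens, s ∈ U ∧ IsAffineOpen U ∧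
    ∃ e : Over.mk U.ι ⟶ total, ∀ (T : Over S) (g : T ⟶ Over.mk U.ι),
      Function.Bijective fun c : Γ(T.left, ⊤) => c • (g ≫ e)

attribute [instance] LineBundle.addCommGroup LineBundle.module

namespace LineBundle

variable {S : Scheme.{u}}

/-- A frame of `V` over the open `U`: a section `e` over `U` such that `c ↦ c • e` is an
isomorphism from the additive group over `U` to the restriction of `V` to `U`. -/
structure Frame (V : LineBundle S) (U : S.Opens) where
  sec : Over.mk U.ι ⟶ V.total
  bijective : ∀ (T : Over S) (g : T ⟶ Over.mk U.ι),
    Function.Bijective fun c : Γ(T.left, ⊤) => c • (g ≫ sec)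

/-- A morphism of `S`-schemes between line bundles is a morphism of group schemes. -/
def IsGroupHom {V W : LineBundle S} (f : V.total ⟶ W.total) : Prop :=
  ∀ (T : Over S) (x y : T ⟶ V.total), (x + y) ≫ f = x ≫ f + y ≫ f

/-- With respect to the frames `e` of `V` and `e'` of `W` over `U`, the morphism `f` is the
polynomial map `c ↦ P(c)`. (For an affine `U` there is exactly one such `P`; it is
`∑ xᵢ X ^ (q ^ i)`, that is `∑ xᵢ τ ^ i`, if `f` is an `𝔽_q`-linear morphism of group schemes.) -/
def IsLocalExpr {V W : LineBundle S} (f : V.total ⟶ W.total) {U : S.Opens}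
    (e : V.Frame U) (e' : W.Frame U) (P : Polynomial Γ(U, ⊤)) : Prop :=
  ∀ (T : Over S) (g : T ⟶ Over.mk U.ι) (c : Γ(T.left, ⊤)),
    (c • (g ≫ e.sec)) ≫ f = (P.eval₂ g.left.appTop.hom c) • (g ≫ e'.sec)

/-- The derivative at `0` of the endomorphism `f` of `V` is the global function `c`: in every
local expression `x₀ X + ⋯` of `f`, the coefficient `x₀` is the restriction of `c`. -/
def HasDerivativeAtZero {V : LineBundle S} (f : V.total ⟶ V.total) (c : Γ(S, ⊤)) : Prop :=
  ∀ (U : S.Opens), IsAffineOpen U → ∀ (e : V.Frame U) (P : Polynomial Γ(U, ⊤)),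
    IsLocalExpr f e e P → P.coeff 1 = U.ι.appTop.hom c

/-- A closed subgroup scheme of (the group scheme underlying) a line bundle. -/
structure ClosedSubgroup (V : LineBundle S) where
  obj : Over S
  incl : obj ⟶ V.total
  isClosedImmersion : IsClosedImmersion incl.left
  exists_zero : ∀ T : Over S, ∃ z : T ⟶ obj, z ≫ incl = 0
  exists_add : ∀ (T : Over S) (x y : T ⟶ obj), ∃ z : T ⟶ obj, z ≫ incl = x ≫ incl + y ≫ incl
  exists_neg : ∀ (T : Over S) (x : T ⟶ obj), ∃ z : T ⟶ obj, z ≫ incl = -(x ≫ incl)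

/-- `G` is the kernel of `f`, as a functor of points. -/
def ClosedSubgroup.IsKernel {V W : LineBundle S} (G : V.ClosedSubgroup)
    (f : V.total ⟶ W.total) : Prop :=
  ∀ (T : Over S) (x : T ⟶ V.total), (∃ y : T ⟶ G.obj, y ≫ G.incl = x) ↔ x ≫ f = 0

/-- With respect to the frame `e` of `V` over `U`, the subgroup `G` is the zero locus of the monic
polynomial `P`. (For a finite flat `G` of constant rank and an affine `U` there is exactly one
such `P`, and the quotient morphism `V → V/G` is locally given by `c ↦ P(c)`.) -/
def ClosedSubgroup.IsLocalEquation {V : LineBundle S} (G : V.ClosedSubgroup) {U : S.Opens}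
    (e : V.Frame U) (P : Polynomial Γ(U, ⊤)) : Prop :=
  P.Monic ∧ ∀ (T : Over S) (g : T ⟶ Over.mk U.ι) (c : Γ(T.left, ⊤)),
    (∃ y : T ⟶ G.obj, y ≫ G.incl = c • (g ≫ e.sec)) ↔ P.eval₂ g.left.appTop.hom c = 0

/-- In the quotient morphism `V → V/G`, locally written as `∑ xᵢ X ^ (q ^ i) = ∑ xᵢ τ ^ i`,
the coefficient `xᵢ` is zero. -/
def ClosedSubgroup.CoeffEqZero {V : LineBundle S} (G : V.ClosedSubgroup) (q i : ℕ) : Prop :=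
  ∀ (U : S.Opens), IsAffineOpen U → ∀ (e : V.Frame U) (P : Polynomial Γ(U, ⊤)),
    G.IsLocalEquation e P → P.coeff (q ^ i) = 0

/-- In the quotient morphism `V → V/G`, locally written as `∑ xᵢ X ^ (q ^ i) = ∑ xᵢ τ ^ i`,
the coefficient `xᵢ` is regular, i.e. not a zero divisor. -/
def ClosedSubgroup.CoeffRegular {V : LineBundle S} (G : V.ClosedSubgroup) (q i : ℕ) : Prop :=
  ∀ (U : S.Opens), IsAffineOpen U → ∀ (e : V.Frame U) (P : Polynomial Γ(U, ⊤)),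
    G.IsLocalEquation e P → P.coeff (q ^ i) ∈ nonZeroDivisors (Γ(U, ⊤) : Type u)

/-- `h` is the height of `G`, that is of the quotient morphism `V → V/G`: the smallest index
with `x_h ≠ 0`. -/
def ClosedSubgroup.HasHeight {V : LineBundle S} (G : V.ClosedSubgroup) (q h : ℕ) : Prop :=
  (∀ i < h, G.CoeffEqZero q i) ∧ ¬ G.CoeffEqZero q h

end LineBundle

/-! Drinfeld modules -/

/-- `A` is the `𝔽_q`-algebra of functions on `X ∖ {∞}`, for a nonsingular projective curve `X`
with field of constants `𝔽_q` and a closed point `∞` of `X`. -/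
def IsCurveCoordinateRing (Fq : Type u) [Field Fq] (A : Type u) [CommRing A] [Algebra Fq A] :
    Prop :=
  ∃ (X : Scheme.{u}) (p : X ⟶ Spec (CommRingCat.of Fq)) (infty : X)
    (hc : IsClosed ({infty} : Set X)),
    IsIntegral X ∧ IsProper p ∧ SmoothOfRelativeDimension 1 p ∧
    Function.Bijective (p.appTop.hom.comp (Scheme.ΓSpecIso (CommRingCat.of Fq)).inv.hom) ∧
    ∃ e : A ≃+* Γ(X, (⟨{infty}ᶜ, hc.isOpen_compl⟩ : X.Opens)),
      ∀ c : Fq, e (algebraMap Fq A c) =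
        (X.presheaf.map (homOfLE le_top).op).hom
          (p.appTop.hom ((Scheme.ΓSpecIso (CommRingCat.of Fq)).inv.hom c))

/-- The ring morphism `γ^♯ : A → Γ(S, 𝒪_S)` of an `A`-scheme `γ : S ⟶ Spec A`. -/
noncomputable def gammaSharp {A : Type u} [CommRing A] {S : Scheme.{u}}
    (γ : S ⟶ Spec (CommRingCat.of A)) : A →+* Γ(S, ⊤) :=
  γ.appTop.hom.comp (Scheme.ΓSpecIso (CommRingCat.of A)).inv.hom

/-- A morphism of group schemes between line bundles over the `A`-scheme `S` that commutes
with the action of `𝔽_q ⊆ A`. -/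
def IsFqLinearHom (Fq : Type u) [Field Fq] {A : Type u} [CommRing A] [Algebra Fq A]
    {S : Scheme.{u}} (γ : S ⟶ Spec (CommRingCat.of A)) {V W : LineBundle S}
    (f : V.total ⟶ W.total) : Prop :=
  LineBundle.IsGroupHom f ∧
  ∀ (c : Fq) (T : Over S) (x : T ⟶ V.total),
    (gammaSharp (T.hom ≫ γ) (algebraMap Fq A c) • x) ≫ f =
      gammaSharp (T.hom ≫ γ) (algebraMap Fq A c) • (x ≫ f)

/-- A Drinfeld module of rank `r` over the `A`-scheme `γ : S ⟶ Spec A`: a line bundle with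
an `𝔽_q`-linear ring morphism `a ↦ φ_a` from `A` to its ring of `𝔽_q`-linear endomorphisms. -/
structure DrinfeldModule (Fq : Type u) [Field Fq] [Fintype Fq] {A : Type u} [CommRing A]
    [Algebra Fq A] {S : Scheme.{u}} (γ : S ⟶ Spec (CommRingCat.of A)) (r : ℕ) where
  rank_pos : 0 < r
  bundle : LineBundle S
  /-- the endomorphism `φ_a` -/
  act : A → (bundle.total ⟶ bundle.total)
  isFqLinearHom : ∀ a, IsFqLinearHom Fq γ (act a)
  act_one : act 1 = 𝟙 bundle.total
  act_mul : ∀ a b, act (a * b) = act b ≫ act a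
  act_add : ∀ (a b : A) (T : Over S) (x : T ⟶ bundle.total),
    x ≫ act (a + b) = x ≫ act a + x ≫ act b
  act_algebraMap : ∀ (c : Fq) (T : Over S) (x : T ⟶ bundle.total),
    x ≫ act (algebraMap Fq A c) = gammaSharp (T.hom ≫ γ) (algebraMap Fq A c) • x
  derivative : ∀ a, a ≠ 0 → LineBundle.HasDerivativeAtZero (act a) (gammaSharp γ a)
  finite : ∀ a, a ≠ 0 → IsFinite (act a).left
  flat : ∀ a, a ≠ 0 → Flat (act a).left
  finrank_eq : ∀ a, a ≠ 0 → ∀ y, (act a).left.finrank y =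
    Fintype.card Fq ^ (r * Module.finrank Fq (A ⧸ Ideal.span {a}))

section

variable {Fq : Type u} [Field Fq] [Fintype Fq] {A : Type u} [CommRing A] [Algebra Fq A]
  {S : Scheme.{u}} {γ : S ⟶ Spec (CommRingCat.of A)}

/-- An isogeny of Drinfeld modules: a finite morphism of group schemes compatible with the
action of `A`. -/
structure Isogeny {r : ℕ} (E F : DrinfeldModule Fq γ r) where
  hom : E.bundle.total ⟶ F.bundle.total
  isGroupHom : LineBundle.IsGroupHom hom
  finite : IsFinite hom.left
  comm : ∀ a : A, E.act a ≫ hom = hom ≫ F.act a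

/-- `G` is stable under the action of `A`. -/
def LineBundle.ClosedSubgroup.IsInvariant {r : ℕ} {E : DrinfeldModule Fq γ r}
    (G : E.bundle.ClosedSubgroup) : Prop :=
  ∀ (a : A) (T : Over S) (x : T ⟶ G.obj), ∃ y : T ⟶ G.obj, y ≫ G.incl = (x ≫ G.incl) ≫ E.act a

end

/-! On small affine opens `G` is cut out by a monic polynomial `P`. Being the equation of a
subgroup, `P` is additive. Stability of `G` under the scalars `𝔽_q ⊆ A`, together with regularity of
the coefficient `x_h`, makes it `𝔽_q`-linear, so `P = x_h X^(q^h) + ⋯` with only exponents `q^i`, `i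
≥ h`. Everything rests on one comparison (`coeff_mul_coeff_one_pow`): if `Q ∘ φ = ψ ∘ Q` and `Q`
starts in degree `m`, the coefficients of `X^m` give `Q_m φ_1^m = Q_m ψ_1`.

Necessity: let `Q` be a local expression of an isogeny with kernel `G`. Then `P` and `Q` have the
same zeros over all test schemes, so each divides the other and `Q = P M` with `M` a unit. The
comparison with `φ = φ_a` and `ψ` the action of `a` on the target has linear coefficients `γ(a)` on
both sides; cancelling `x_h` and the unit `M(0)` leaves `γ(a)^(q^h) = γ(a)`.

Sufficiency: the quotient by `G` is built by hand. By connectedness `P` has constant degree `p^k`,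
and rescaling a frame by a unit `u` rescales `P` by `u^(p^k)`. These are the transition functions of
the `p^k`-Frobenius twist of the line bundle, so the `P`'s glue to a morphism `ξ` into that twist
with kernel `G` (`exists_hom_of_localExpr`). Invariance of `G` gives `P ∣ P ∘ φ_a`; right division
(`IsAdditive.exists_eq_comp`) gives `P ∘ φ_a = D_a ∘ P`, and the `D_a` glue (`exists_factor`). Since
`ξ` is an epimorphism, the ring axioms pass from `φ` to `D`. The comparison yields `D_a = γ(a)^(q^h)
X + ⋯`, and the hypothesis turns this into the required derivative. Finiteness and flatness of `D_a`
descend along the free extension given by `P`, and its rank comes from comparing degrees over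
residue fields (`finite_flat_finrank`). -/

/-! ### Additive polynomials in characteristic `p` -/

namespace AdditivePolynomial

open Polynomial

section

variable {R : Type u} [CommRing R]

/-- The polynomial `f` induces additive maps on all `R`-algebras. -/
def IsAdditive (f : R[X]) : Prop :=
  ∀ ⦃R' : Type u⦄ [CommRing R'] (φ : R →+* R') (x y : R'),
    f.eval₂ φ (x + y) = f.eval₂ φ x + f.eval₂ φ y

lemma IsAdditive.zero : IsAdditive (0 : R[X]) := fun _ _ _ _ _ => by simp

lemma IsAdditive.sub {f g : R[X]} (hf : IsAdditive f) (hg : IsAdditive g) :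
    IsAdditive (f - g) := fun R' _ φ x y => by
  rw [eval₂_sub, eval₂_sub, eval₂_sub, hf φ x y, hg φ x y]; ring

lemma IsAdditive.add {f g : R[X]} (hf : IsAdditive f) (hg : IsAdditive g) :
    IsAdditive (f + g) := fun R' _ φ x y => by
  rw [eval₂_add, eval₂_add, eval₂_add, hf φ x y, hg φ x y]; ring

lemma IsAdditive.C_mul {f : R[X]} (hf : IsAdditive f) (a : R) :
    IsAdditive (C a * f) := fun R' _ φ x y => by
  simp only [eval₂_mul, eval₂_C, hf φ x y]; ring

lemma IsAdditive.comp {f g : R[X]} (hf : IsAdditive f) (hg : IsAdditive g) :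
    IsAdditive (f.comp g) := fun R' _ φ x y => by
  simp only [eval₂_comp, hg φ x y, hf φ]

lemma isAdditive_X : IsAdditive (X : R[X]) := fun _ _ _ _ _ => by simp

lemma IsAdditive.pow_char_pow {p : ℕ} (hp : p.Prime) (hR : (p : R) = 0) {f : R[X]}
    (hf : IsAdditive f) (i : ℕ) : IsAdditive (f ^ p ^ i) := fun R' _ φ x y => by
  rcases subsingleton_or_nontrivial R' with h | h
  · exact Subsingleton.elim _ _
  · have hc : (p : R') = 0 := by rw [← map_natCast φ, hR, map_zero]
    have : Fact p.Prime := ⟨hp⟩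
    have : CharP R' p := (CharP.charP_iff_prime_eq_zero hp).2 hc
    rw [eval₂_pow, eval₂_pow, eval₂_pow, hf φ x y, add_pow_char_pow]

lemma IsAdditive.finset_sum {ι : Type*} (s : Finset ι) {f : ι → R[X]}
    (hf : ∀ i ∈ s, IsAdditive (f i)) : IsAdditive (∑ i ∈ s, f i) := by
  classical
  induction s using Finset.induction_on with
  | empty => simpa using IsAdditive.zero
  | insert a s ha ih =>
    rw [Finset.sum_insert ha]
    exact (hf a (by simp)).add (ih fun i hi => hf i (by simp [hi]))

lemma IsAdditive.of_coeff {p : ℕ} (hp : p.Prime) (hR : (p : R) = 0) {f : R[X]}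
    (hf : ∀ m, f.coeff m ≠ 0 → ∃ i, m = p ^ i) : IsAdditive f := by
  rw [f.as_sum_support_C_mul_X_pow]
  refine IsAdditive.finset_sum _ fun m hm => ?_
  obtain ⟨i, rfl⟩ := hf m (mem_support_iff.1 hm)
  exact (isAdditive_X.pow_char_pow hp hR i).C_mul _

lemma hasseDeriv_map {R' : Type*} [CommRing R'] (φ : R →+* R') (f : R[X]) (j : ℕ) :
    hasseDeriv j (f.map φ) = (hasseDeriv j f).map φ := by
  ext m
  simp [hasseDeriv_coeff]

/-- The coefficient of `X^(m-j)` in the `j`-th Hasse derivative is `(m choose j) f_m`, so it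
vanishes for `0 < j < m`. A binomial coefficient prime to `p` is invertible in `R` and would kill
`f_m`; hence all of them are divisible by `p`, which forces `m` to be a power of `p`. -/
lemma exists_eq_pow_of_hasseDeriv {p : ℕ} (hp : p.Prime) (hR : (p : R) = 0) {f : R[X]}
    (h0 : f.coeff 0 = 0) (hf : ∀ j, 1 ≤ j → hasseDeriv j f = C (f.coeff j)) (m : ℕ)
    (hm : f.coeff m ≠ 0) : ∃ i, m = p ^ i := by
  have : Fact p.Prime := ⟨hp⟩
  have hm0 : 0 < m := Nat.pos_of_ne_zero (by rintro rfl; exact hm h0)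
  refine ⟨_, Choose.eq_pow_multiplicity_of_choose_modEq_zero_nat hm0 fun i hi => ?_⟩
  rw [Nat.modEq_zero_iff_dvd]
  by_contra hdvd
  rw [Finset.mem_Icc] at hi
  have h1 := congrArg (fun g => g.coeff (m - i)) (hf i hi.1)
  simp only [hasseDeriv_coeff, coeff_C] at h1
  rw [if_neg (by omega), Nat.sub_add_cancel (by omega)] at h1
  have hcop : IsCoprime ((m.choose i : ℕ) : ℤ) (p : ℤ) :=
    Nat.isCoprime_iff_coprime.2 ((Nat.Prime.coprime_iff_not_dvd hp).2 hdvd).symm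
  obtain ⟨a, b, hab⟩ := hcop
  have h2 : ((a * (m.choose i : ℕ) + b * p : ℤ) : R) = 1 := by rw [hab]; simp
  push_cast at h2
  rw [hR, mul_zero, add_zero] at h2
  apply hm
  rw [← one_mul (f.coeff m), ← h2, mul_assoc, h1, mul_zero]

lemma IsAdditive.coeff_zero {f : R[X]} (hf : IsAdditive f) : f.coeff 0 = 0 := by
  have := hf (RingHom.id R) 0 0
  simpa [coeff_zero_eq_eval_zero] using this

/-- Additivity for two independent variables in `R[X][X]` computes the Taylor expansion of `f`,
whose coefficients are the Hasse derivatives. -/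
lemma IsAdditive.hasseDeriv_eq {f : R[X]} (hf : IsAdditive f) (j : ℕ) (hj : 1 ≤ j) :
    hasseDeriv j f = Polynomial.C (f.coeff j) := by
  have h : taylor (X : R[X]) (f.map C) = f.map C + C f := by
    have := hf ((C : R[X] →+* R[X][X]).comp C) X (C X)
    rw [taylor_apply, Polynomial.comp, eval₂_map, this, ← eval₂_map, eval₂_C_X, ← hom_eval₂,
      eval₂_C_X]
  have h2 := congrArg (fun g => g.coeff j) h
  simp only [taylor_coeff, coeff_add, coeff_map, coeff_C] at h2
  rw [if_neg (by omega), add_zero, hasseDeriv_map, Polynomial.eval_map, eval₂_C_X] at h2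
  exact h2

lemma IsAdditive.exists_eq_pow {p : ℕ} (hp : p.Prime) (hR : (p : R) = 0) {f : R[X]}
    (hf : IsAdditive f) (m : ℕ) (hm : f.coeff m ≠ 0) : ∃ i, m = p ^ i :=
  exists_eq_pow_of_hasseDeriv hp hR hf.coeff_zero hf.hasseDeriv_eq m hm

/-- A monic polynomial whose zeros form a subgroup of the additive group is additive. -/
lemma isAdditive_of_dvd_comp {p : ℕ} (hp : p.Prime) (hR : (p : R) = 0) {P : R[X]}
    (hP : P.Monic) (h0 : P.coeff 0 = 0)
    (h : P.map (AdjoinRoot.of P) ∣ taylor (AdjoinRoot.root P) (P.map (AdjoinRoot.of P))) :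
    IsAdditive P := by
  refine IsAdditive.of_coeff hp hR (exists_eq_pow_of_hasseDeriv hp hR h0 fun j hj => ?_)
  rcases subsingleton_or_nontrivial R with _ | _
  · exact Subsingleton.elim _ _
  have hm := hP.map (AdjoinRoot.of P)
  have hmt : (taylor (AdjoinRoot.root P) (P.map (AdjoinRoot.of P))).Monic := by
    rw [Monic, leadingCoeff_taylor]; exact hm
  -- The translate by the tautological zero is monic of the same degree as `P`, so divisibility is
  -- equality.
  have heq := eq_of_monic_of_dvd_of_natDegree_le hm hmt h (by rw [natDegree_taylor])
  have h2 := congrArg (fun g => g.coeff j) heq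
  simp only [taylor_coeff, coeff_map] at h2
  rw [hasseDeriv_map, Polynomial.eval_map, ← AdjoinRoot.algebraMap_eq, ← aeval_def, AdjoinRoot.aeval_eq,
    AdjoinRoot.algebraMap_eq, ← AdjoinRoot.mk_C, AdjoinRoot.mk_eq_mk] at h2
  -- So far the `j`-th Hasse derivative agrees with the constant `P_j` only modulo `P`. Their
  -- difference has degree less than `deg P`, so it is zero.
  by_contra hne
  refine hP.not_dvd_of_natDegree_lt (sub_ne_zero.2 hne) ?_ h2
  refine (natDegree_sub_C).trans_lt ((natDegree_hasseDeriv_le P j).trans_lt ?_)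
  have : P.natDegree ≠ 0 := by
    intro hd
    rw [hP.natDegree_eq_zero.1 hd] at h0
    simp at h0
  omega

lemma IsAdditive.exists_natDegree_eq_pow {p : ℕ} (hp : p.Prime) (hR : (p : R) = 0) [Nontrivial R]
    {f : R[X]} (hf : IsAdditive f) (hm : f.Monic) : ∃ i, f.natDegree = p ^ i :=
  hf.exists_eq_pow hp hR _ (by rw [hm.coeff_natDegree]; exact one_ne_zero)

/-- Follows from `gcd(p^f - 1, p^i - 1) = p^gcd(f, i) - 1`, which gives `f ∣ i`. -/
lemma exists_pow_eq_pow_pow {p f i : ℕ} (hp : p.Prime)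
    (h : p ^ f - 1 ∣ p ^ i - 1) : ∃ k, p ^ i = (p ^ f) ^ k := by
  have h1 := Nat.pow_sub_one_gcd_pow_sub_one p f i
  rw [Nat.gcd_eq_left h] at h1
  have h2 : p ^ f = p ^ f.gcd i := by
    have := Nat.pow_pos (n := f) hp.pos
    have := Nat.pow_pos (n := f.gcd i) hp.pos
    omega
  have h3 : f = f.gcd i := Nat.pow_right_injective hp.two_le h2
  obtain ⟨k, hk⟩ : f ∣ i := by rw [h3]; exact Nat.gcd_dvd_right _ _
  exact ⟨k, by rw [hk, pow_mul]⟩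

/-- An `𝔽_q`-linear polynomial only involves the monomials `X ^ (q ^ i)`. -/
lemma IsAdditive.exists_eq_card_pow {Fq : Type*} [Field Fq] [Fintype Fq] (κ : Fq →+* R)
    {f : R[X]} (hf : IsAdditive f) (hlin : ∀ c, f.comp (C (κ c) * X) = C (κ c) * f)
    (m : ℕ) (hm : f.coeff m ≠ 0) : ∃ i, m = Fintype.card Fq ^ i := by
  obtain ⟨p, hchar⟩ := CharP.exists Fq
  obtain ⟨e, hp, hcard⟩ := FiniteField.card Fq p
  have hR : (p : R) = 0 := by rw [← map_natCast κ, CharP.cast_eq_zero, map_zero]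
  obtain ⟨i, rfl⟩ := hf.exists_eq_pow hp hR m hm
  -- For a generator `c` of the unit group, of order `q - 1`, linearity gives `c^(p^i) = c`, hence
  -- `q - 1 ∣ p^i - 1`.
  obtain ⟨c, hc⟩ := IsCyclic.exists_generator (α := Fqˣ)
  have hord : orderOf c = p ^ (e : ℕ) - 1 := by
    rw [orderOf_eq_card_of_forall_mem_zpowers hc, Nat.card_units, Nat.card_eq_fintype_card, hcard]
  have h1 := congrArg (fun g => g.coeff (p ^ i)) (hlin c)
  simp only [comp_C_mul_X_coeff, coeff_C_mul] at h1
  have h2 : (c : Fq) ^ p ^ i = c := by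
    by_contra hne
    have hu : IsUnit (κ ((c : Fq) ^ p ^ i - c)) := (IsUnit.mk0 _ (sub_ne_zero.2 hne)).map κ
    apply hm
    rw [← hu.mul_right_eq_zero, map_sub, map_pow, sub_mul, ← h1]
    ring
  have h3 : c ^ (p ^ i - 1) = 1 := by
    have h4 : c ^ (p ^ i - 1) * c = 1 * c := by
      rw [← pow_succ, Nat.sub_add_cancel (Nat.pow_pos hp.pos), one_mul]
      exact Units.ext (by simpa using h2)
    exact mul_right_cancel h4
  have h5 := orderOf_dvd_of_pow_eq_one h3
  rw [hord] at h5
  obtain ⟨k, hk⟩ := exists_pow_eq_pow_pow hp h5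
  exact ⟨k, by rw [hcard, hk]⟩

/-- For degree reasons `P(cX) = λP` with a constant `λ`. The coefficient of `X^m`, being regular,
identifies `λ` with `c^m = c`. The degree of `P` need not be known. -/
lemma comp_C_mul_X_eq {P : R[X]} (hP : P.Monic) {c : R} {m : ℕ}
    (hdvd : P ∣ P.comp (C c * X)) (hreg : P.coeff m ∈ nonZeroDivisors R) (hc : c ^ m = c) :
    P.comp (C c * X) = C c * P := by
  have hdeg : (P.comp (C c * X)).natDegree ≤ P.natDegree := by
    refine natDegree_comp_le.trans ?_
    calc _ ≤ P.natDegree * 1 := Nat.mul_le_mul_left _ ((natDegree_C_mul_le c X).trans natDegree_X_le)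
      _ = _ := mul_one _
  have h := eq_mul_leadingCoeff_of_monic_of_dvd_of_natDegree_le hP hdvd hdeg
  have h1 := congrArg (fun g => g.coeff m) h
  simp only [comp_C_mul_X_coeff, coeff_mul_C, hc] at h1
  have h2 := mem_nonZeroDivisors_iff_right.1 hreg
    (c - (P.comp (C c * X)).leadingCoeff) (by rw [sub_mul, mul_comm c, h1]; ring)
  rw [← sub_eq_zero.1 h2] at h
  rw [h, mul_comm]

/-- Composing on the right with a monic nonconstant polynomial preserves the leading coefficient. -/
lemma comp_injective {P : R[X]} (hP : P.Monic) (hd : P.natDegree ≠ 0) :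
    Function.Injective fun D : R[X] => D.comp P := by
  intro D D' h
  have h0 : (D - D').comp P = 0 := by rw [sub_comp]; exact sub_eq_zero.2 h
  have h1 := coeff_comp_degree_mul_degree (p := D - D') (q := P) hd
  rw [h0, coeff_zero, hP.leadingCoeff, one_pow, mul_one] at h1
  exact sub_eq_zero.1 (leadingCoeff_eq_zero.1 h1.symm)

/-- Right division of additive polynomials. -/
lemma IsAdditive.exists_eq_comp {p : ℕ} (hp : p.Prime) (hR : (p : R) = 0) {P : R[X]}
    (hP : P.Monic) (hadd : IsAdditive P) {f : R[X]} (hf : IsAdditive f) (hdvd : P ∣ f) :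
    ∃ D : R[X], IsAdditive D ∧ f = D.comp P := by
  rcases subsingleton_or_nontrivial R with _ | _
  · exact ⟨0, .zero, Subsingleton.elim _ _⟩
  obtain ⟨k, hk⟩ := hadd.exists_natDegree_eq_pow hp hR hP
  induction hd : f.natDegree using Nat.strong_induction_on generalizing f with
  | _ d ih =>
  rcases eq_or_ne f 0 with rfl | hf0
  · exact ⟨0, .zero, by simp⟩
  obtain ⟨m, hm⟩ := hf.exists_eq_pow hp hR f.natDegree (leadingCoeff_ne_zero.2 hf0)
  have hle : P.natDegree ≤ f.natDegree := by
    by_contra! hlt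
    exact hP.not_dvd_of_natDegree_lt hf0 hlt hdvd
  have hkm : k ≤ m := by
    rw [hk, hm] at hle
    exact (Nat.pow_le_pow_iff_right hp.one_lt).1 hle
  -- `P^(p^(m-k))` is additive of degree `p^k · p^(m-k) = deg f`, divisible by `P`, and of the form
  -- `(X^(p^(m-k))) ∘ P`; subtracting `B` removes the leading term of `f`.
  set B := C f.leadingCoeff * P ^ p ^ (m - k) with hB
  have hBadd : IsAdditive B := (hadd.pow_char_pow hp hR _).C_mul _
  have hBdvd : P ∣ B := (dvd_pow_self P (Nat.pow_pos hp.pos).ne').mul_left _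
  have hBdeg : B.natDegree = f.natDegree := by
    rw [hB, mul_comm, (hP.pow _).natDegree_mul' (by simpa using hf0), natDegree_C, add_zero,
      hP.natDegree_pow, hk, hm, ← pow_add]
    congr 1; omega
  have hBlead : B.leadingCoeff = f.leadingCoeff := by
    rw [hB, leadingCoeff_mul_monic (hP.pow _), leadingCoeff_C]
  have hfd : f.natDegree ≠ 0 := by rw [hm]; exact (Nat.pow_pos hp.pos).ne'
  have hlt : (f - B).natDegree < d := by
    rw [← hd]
    by_cases h0 : f - B = 0
    · rw [h0, natDegree_zero]; omega
    · have hB0 : B ≠ 0 := by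
        rw [← leadingCoeff_ne_zero, hBlead]; exact leadingCoeff_ne_zero.2 hf0
      refine natDegree_lt_natDegree h0 (degree_sub_lt_left ?_ hf0 hBlead.symm)
      rw [degree_eq_natDegree hf0, degree_eq_natDegree hB0, hBdeg]
  obtain ⟨D, hD, hDf⟩ := ih _ hlt (hf.sub hBadd) (dvd_sub hdvd hBdvd) rfl
  refine ⟨D + C f.leadingCoeff * X ^ p ^ (m - k),
    hD.add ((isAdditive_X.pow_char_pow hp hR _).C_mul _), ?_⟩
  rw [add_comp, ← hDf, mul_comp, C_comp, pow_comp, X_comp, sub_add_cancel]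

lemma X_pow_dvd_of_coeff {f : R[X]} {q h : ℕ} (hq : 1 < q)
    (hf : ∀ m, f.coeff m ≠ 0 → ∃ i, m = q ^ i) (h0 : ∀ i < h, f.coeff (q ^ i) = 0) :
    X ^ q ^ h ∣ f := by
  rw [X_pow_dvd_iff]
  intro d hd
  by_contra hne
  obtain ⟨i, rfl⟩ := hf d hne
  exact hne (h0 i ((Nat.pow_lt_pow_iff_right hq).1 hd))

/-- Write `Q = X^m Q'`. On the left the lowest term of `Q ∘ φ` is `Q'(0) (φ_1 X)^m`, on the right
that of `ψ ∘ Q` is `ψ_1 Q'(0) X^m`. This is where the exponent `q^h` in the theorem comes from. -/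
lemma coeff_mul_coeff_one_pow {Q φ ψ : R[X]} {m : ℕ} (hQ : X ^ m ∣ Q) (hm : m ≠ 0)
    (hφ : φ.coeff 0 = 0) (hψ : ψ.coeff 0 = 0) (h : Q.comp φ = ψ.comp Q) :
    Q.coeff m * φ.coeff 1 ^ m = Q.coeff m * ψ.coeff 1 := by
  obtain ⟨Q, rfl⟩ := hQ
  obtain ⟨φ, rfl⟩ := X_dvd_iff.2 hφ
  obtain ⟨ψ, rfl⟩ := X_dvd_iff.2 hψ
  rw [mul_comp, mul_comp, X_comp, pow_comp, X_comp, mul_pow, mul_assoc, mul_assoc] at h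
  have h1 := congrArg (fun g => g.coeff (0 + m)) h
  have e (g : R[X]) : (X ^ m * g).coeff m = g.eval 0 := by
    have := coeff_mul_X_pow g m 0
    rwa [zero_add, mul_comm, coeff_zero_eq_eval_zero] at this
  have e1 (g : R[X]) : (X * g).coeff 1 = g.eval 0 := by
    rw [mul_comm, coeff_mul_X, coeff_zero_eq_eval_zero]
  simp only [zero_add, e] at h1
  rw [e, e1, e1]
  simp only [eval_mul, eval_comp, eval_pow, eval_X, zero_mul, zero_pow hm] at h1
  rw [← h1, mul_comm]

end

end AdditivePolynomial

/-! ### The endomorphism `X ↦ D(X)` of `R[X]`: finiteness, flatness, rank -/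

namespace AdditivePolynomial

open Polynomial TensorProduct

section

variable {R : Type u} [CommRing R]

/-- The ring `R[X]` as an algebra over `R[X]` through `p ↦ p.comp D`. -/
def Along (_D : R[X]) : Type u := R[X]

noncomputable instance (D : R[X]) : CommRing (Along D) := inferInstanceAs (CommRing R[X])

noncomputable instance (D : R[X]) : Algebra R[X] (Along D) := (compRingHom D).toAlgebra

/-- The polynomial `D(X) - Y` in the variable `X` over `R[Y]`. -/
noncomputable def graphPoly (D : R[X]) : R[X][X] := D.map C - C X

noncomputable def alongToAdjoinRoot (D : R[X]) : R[X] →+* AdjoinRoot (graphPoly D) :=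
  eval₂RingHom ((AdjoinRoot.of (graphPoly D)).comp C) (AdjoinRoot.root (graphPoly D))

lemma alongToAdjoinRoot_self (D : R[X]) :
    alongToAdjoinRoot D D = AdjoinRoot.of (graphPoly D) X := by
  have h := AdjoinRoot.eval₂_root (graphPoly D)
  rw [graphPoly, eval₂_sub, eval₂_map, eval₂_C, sub_eq_zero] at h
  exact h

noncomputable def alongOfAdjoinRoot (D : R[X]) : AdjoinRoot (graphPoly D) →+* R[X] :=
  AdjoinRoot.lift (compRingHom D) X (by
    have : (compRingHom D).comp C = C := by ext; simp
    rw [graphPoly, eval₂_sub, eval₂_map, eval₂_C, sub_eq_zero, this, eval₂_C_X]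
    simp)

/-- Eliminating `Y = D(X)` from `R[Y][X]`. For monic `D` it makes `R[X]` free over itself; for
arbitrary `D` it still computes fibre ranks. -/
noncomputable def alongRingEquiv (D : R[X]) : AdjoinRoot (graphPoly D) ≃+* R[X] :=
  RingEquiv.ofRingHom (alongOfAdjoinRoot D) (alongToAdjoinRoot D)
    (by
      refine ringHom_ext (fun a => ?_) ?_
      · simp [alongToAdjoinRoot, alongOfAdjoinRoot]
      · simp [alongToAdjoinRoot, alongOfAdjoinRoot])
    (by
      refine AdjoinRoot.ringHom_ext ?_ ?_
      · refine ringHom_ext (fun a => ?_) ?_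
        · simp [alongToAdjoinRoot, alongOfAdjoinRoot]
        · simpa [alongOfAdjoinRoot] using alongToAdjoinRoot_self D
      · simp [alongToAdjoinRoot, alongOfAdjoinRoot])

noncomputable def alongEquiv (D : R[X]) : AdjoinRoot (graphPoly D) ≃ₐ[R[X]] Along D :=
  { (alongRingEquiv D : AdjoinRoot (graphPoly D) ≃+* Along D) with
    commutes' := fun _ => AdjoinRoot.lift_of (f := graphPoly D) _ }

lemma graphPoly_monic {P : R[X]} (hP : P.Monic) (hd : P.natDegree ≠ 0) :
    (graphPoly P).Monic := by
  rcases subsingleton_or_nontrivial R with _ | _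
  · exact Subsingleton.elim _ _
  refine (hP.map C).sub_of_left (degree_C_le.trans_lt ?_)
  rw [← natDegree_pos_iff_degree_pos, hP.natDegree_map]
  omega

noncomputable def alongBasis {P : R[X]} (hP : P.Monic) (hd : P.natDegree ≠ 0) :
    Module.Basis (Fin (graphPoly P).natDegree) R[X] (Along P) :=
  (IsAdjoinRootMonic.basis
    (AdjoinRoot.isAdjoinRootMonic _ (graphPoly_monic hP hd))).map (alongEquiv P).toLinearEquiv

lemma finite_compRingHom {P : R[X]} (hP : P.Monic) (hd : P.natDegree ≠ 0) :
    (compRingHom P).Finite :=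
  have : Module.Finite R[X] (Along P) := Module.Finite.of_basis (alongBasis hP hd)
  this

lemma flat_compRingHom {P : R[X]} (hP : P.Monic) (hd : P.natDegree ≠ 0) :
    (compRingHom P).Flat :=
  have := Module.Free.of_basis (alongBasis hP hd)
  inferInstanceAs (Module.Flat R[X] (Along P))

/-- The coordinate at `1` in the power basis of `R[X]` over its subring `R[P]` is a linear
retraction. -/
lemma exists_retraction {P : R[X]} (hP : P.Monic) (hd : P.natDegree ≠ 0) :
    ∃ ρ : R[X] →+ R[X], ρ 1 = 1 ∧ ∀ a b, ρ (a.comp P * b) = a * ρ b := by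
  rcases subsingleton_or_nontrivial R with _ | _
  · exact ⟨0, Subsingleton.elim _ _, fun _ _ => Subsingleton.elim _ _⟩
  have hpos : 0 < (graphPoly P).natDegree := by
    rw [graphPoly, natDegree_sub_C, hP.natDegree_map]; omega
  have h1 : alongBasis hP hd ⟨0, hpos⟩ = 1 := by
    simp [alongBasis, IsAdjoinRootMonic.basis_apply]
  refine ⟨((alongBasis hP hd).coord ⟨0, hpos⟩).toAddMonoidHom, ?_, fun a b => ?_⟩
  · change (alongBasis hP hd).coord ⟨0, hpos⟩ (1 : Along P) = 1
    rw [← h1]; simp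
  · exact ((alongBasis hP hd).coord ⟨0, hpos⟩).map_smul a (b : Along P)

end

/-- If `B` is a retract of the `B`-algebra `C`, then finiteness and flatness of `A → C`
descend to `A → B`. -/
lemma finite_flat_of_retraction {A B C : Type u} [CommRing A] [CommRing B] [CommRing C]
    (f : A →+* B) (g : B →+* C) (hfin : (g.comp f).Finite) (hflat : (g.comp f).Flat)
    (ρ : C →+ B) (h1 : ρ 1 = 1) (hρ : ∀ b c, ρ (g b * c) = b * ρ c) : f.Finite ∧ f.Flat := by
  algebraize [f, g, g.comp f]
  let ρ' : C →ₗ[A] B := { ρ with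
    map_smul' := fun a c => by
      change ρ (a • c) = a • ρ c
      rw [Algebra.smul_def, Algebra.smul_def]
      exact hρ _ _ }
  let i : B →ₗ[A] C := (IsScalarTower.toAlgHom A B C).toLinearMap
  have hi : ρ' ∘ₗ i = LinearMap.id := by
    ext b
    change ρ (g b) = b
    have := hρ b 1
    rwa [mul_one, h1, mul_one] at this
  constructor
  · change Module.Finite A B
    refine Module.Finite.of_surjective ρ' fun b => ⟨i b, LinearMap.congr_fun hi b⟩
  · change Module.Flat A B
    exact Module.Flat.of_retract i ρ' hi

section

variable {R : Type u} [CommRing R]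

lemma compRingHom_comp (D P : R[X]) :
    compRingHom (D.comp P) = (compRingHom P).comp (compRingHom D) := by
  ext <;> simp

/-- Nothing is known about the leading coefficient of `D`. But following `X ↦ D` by `X ↦ P` gives
the same ring map as following `X ↦ P` by `X ↦ φ`, which is finite and flat, and the outer factor `X
↦ P` has a linear retraction. -/
lemma finite_flat_compRingHom_of_comp_eq {P φ D : R[X]} (hP : P.Monic) (hd : P.natDegree ≠ 0)
    (hfin : (compRingHom φ).Finite) (hflat : (compRingHom φ).Flat)
    (h : P.comp φ = D.comp P) : (compRingHom D).Finite ∧ (compRingHom D).Flat := by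
  obtain ⟨ρ, h1, hρ⟩ := exists_retraction hP hd
  have e : (compRingHom P).comp (compRingHom D) = (compRingHom φ).comp (compRingHom P) := by
    rw [← compRingHom_comp, ← h, compRingHom_comp]
  refine finite_flat_of_retraction (compRingHom D) (compRingHom P) ?_ ?_ ρ h1 hρ
  · rw [e]; exact hfin.comp (finite_compRingHom hP hd)
  · rw [e]; exact (flat_compRingHom hP hd).comp hflat

/-- No monicity is needed: if `F` maps to zero in `K[X]`, both sides take the default value `0`. -/
lemma finrank_tensor_adjoinRoot {A K : Type u} [CommRing A] [Field K] [Algebra A K] (F : A[X]) :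
    Module.finrank K (K ⊗[A] AdjoinRoot F) = (F.map (algebraMap A K)).natDegree := by
  let e : K ⊗[A] AdjoinRoot F ≃ₐ[K] AdjoinRoot (F.map (algebraMap A K)) :=
    AlgEquiv.ofAlgHom
      (Algebra.TensorProduct.lift (Algebra.ofId K _)
        (AdjoinRoot.liftAlgHom F (Algebra.ofId A _) (AdjoinRoot.root (F.map (algebraMap A K))) (by
          have h := AdjoinRoot.eval₂_root (F.map (algebraMap A K))
          rw [eval₂_map] at h
          exact h))
        (fun _ _ => Commute.all _ _))
      (AdjoinRoot.liftAlgHom _ (Algebra.ofId K _) (1 ⊗ₜ AdjoinRoot.root F) (by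
        rw [eval₂_map]
        have h := congrArg (Algebra.TensorProduct.includeRight : _ →ₐ[A] K ⊗[A] AdjoinRoot F)
          (AdjoinRoot.eval₂_root F)
        rw [map_zero] at h
        refine Eq.trans ?_ h
        rw [← AlgHom.coe_toRingHom, hom_eval₂]
        congr 1
        ext a
        exact Algebra.TensorProduct.tmul_one_eq_one_tmul a))
      (by
        ext
        simpa using AdjoinRoot.liftAlgHom_root _ _ _ _)
      (by
        ext
        simpa using (congrArg _ (AdjoinRoot.liftAlgHom_root _ _ _ _)).trans
          (AdjoinRoot.liftAlgHom_root _ _ _ _))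
  rw [e.toLinearEquiv.finrank_eq]
  exact finrank_quotient_span_eq_natDegree

/-- The fibre at `x` is `K[X] / (D(X) - y)` with `K` the residue field, and the constant `y` does
not affect the degree. -/
lemma finrank_compRingHom {D : R[X]} (hfin : (compRingHom D).Finite)
    (hflat : (compRingHom D).Flat) (x : PrimeSpectrum R[X]) :
    (compRingHom D).finrank x =
      (D.map ((algebraMap R[X] x.asIdeal.ResidueField).comp C)).natDegree := by
  have : Module.Finite R[X] (Along D) := hfin
  have : Module.Flat R[X] (Along D) := hflat
  change Module.rankAtStalk (Along D) x = _
  rw [← Module.rankAtStalk_eq_of_equiv (alongEquiv D).toLinearEquiv]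
  have := Module.Finite.equiv (alongEquiv D).symm.toLinearEquiv
  have := Module.Flat.of_linearEquiv (alongEquiv D).toLinearEquiv
  rw [Module.rankAtStalk_eq]
  refine (finrank_tensor_adjoinRoot _).trans ?_
  rw [graphPoly, Polynomial.map_sub, map_C, natDegree_sub_C, Polynomial.map_map]

end

end AdditivePolynomial

/-! ### Monic equations for finite flat quotients of `R[X]` -/

namespace AdditivePolynomial

open Polynomial TensorProduct

section

/-- Take the characteristic polynomial of multiplication by `x`. By Cayley–Hamilton `R[X]/(P)`
surjects onto `B`; both are free of the same rank, so the surjection is bijective. -/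
lemma exists_monic_forall_aeval_eq_zero_iff {R B : Type u} [CommRing R] [CommRing B] [Algebra R B]
    [Module.Free R B] [Module.Finite R B] (x : B)
    (hx : Function.Surjective (aeval x : R[X] →ₐ[R] B)) :
    ∃ P : R[X], P.Monic ∧ ∀ f : R[X], aeval x f = 0 ↔ P ∣ f := by
  rcases subsingleton_or_nontrivial R with _ | _
  · have : Subsingleton B := Module.subsingleton R B
    exact ⟨0, Subsingleton.elim _ _, fun f =>
      ⟨fun _ => by rw [Subsingleton.elim f 0], fun _ => Subsingleton.elim _ _⟩⟩
  set P := (Algebra.lmul R B x).charpoly with hPdef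
  have hP : P.Monic := LinearMap.charpoly_monic _
  have hPx : aeval x P = 0 := by
    have h := LinearMap.aeval_self_charpoly (Algebra.lmul R B x)
    rw [aeval_algHom_apply] at h
    have h1 := LinearMap.congr_fun h 1
    rw [hPdef]
    simpa using h1
  refine ⟨P, hP, fun f => ⟨fun hf => ?_, ?_⟩⟩
  · let φ : AdjoinRoot P →ₐ[R] B := AdjoinRoot.liftAlgHom P (Algebra.ofId R B) x hPx
    have hsurj : Function.Surjective φ := fun b => by
      obtain ⟨g, rfl⟩ := hx b
      exact ⟨AdjoinRoot.mk P g, AdjoinRoot.liftAlgHom_mk _ _ _ _ _⟩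
    have := (AdjoinRoot.isAdjoinRootMonic P hP).finite
    have : Module.Free R (AdjoinRoot P) :=
      Module.Free.of_basis (AdjoinRoot.isAdjoinRootMonic P hP).basis
    have hbij := OrzechProperty.bijective_of_surjective_of_finrank_le φ.toLinearMap hsurj (by
      rw [(AdjoinRoot.isAdjoinRootMonic P hP).finrank, hPdef, LinearMap.charpoly_natDegree])
    rw [← AdjoinRoot.mk_eq_zero]
    apply hbij.1
    rw [map_zero]
    exact (AdjoinRoot.liftAlgHom_mk P _ x hPx f).trans hf
  · rintro ⟨g, rfl⟩
    rw [map_mul, hPx, zero_mul]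

section

variable {R Q : Type u} (L : Type u) [CommRing R] [CommRing L] [Algebra R L] [CommRing Q]
  [Algebra R Q] (q : R[X] →ₐ[R] Q)

lemma aeval_one_tmul (f : R[X]) :
    aeval ((1 : L) ⊗ₜ[R] q X) (f.map (algebraMap R L)) = (1 : L) ⊗ₜ[R] q f := by
  have : (1 : L) ⊗ₜ[R] q X = (Algebra.TensorProduct.includeRight : _ →ₐ[R] L ⊗[R] Q) (q X) := rfl
  rw [aeval_map_algebraMap, this, aeval_algHom_apply]
  change _ = (Algebra.TensorProduct.includeRight : _ →ₐ[R] L ⊗[R] Q) (q f)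
  rw [aeval_algHom_apply, aeval_X_left_apply]

variable {q}

lemma aeval_one_tmul_surjective (hq : Function.Surjective q) :
    Function.Surjective (aeval (R := L) ((1 : L) ⊗ₜ[R] q X)) := by
  intro b
  induction b using TensorProduct.induction_on with
  | zero => exact ⟨0, map_zero _⟩
  | tmul a b =>
    obtain ⟨f, rfl⟩ := hq b
    exact ⟨a • f.map (algebraMap R L), by
      rw [map_smul, aeval_one_tmul, TensorProduct.smul_tmul', smul_eq_mul, mul_one]⟩
  | add a b ha hb =>
    obtain ⟨f, rfl⟩ := ha
    obtain ⟨g, rfl⟩ := hb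
    exact ⟨f + g, map_add _ _ _⟩

variable {L}

/-- A zero `c` of the ideal `ker q` is an `R`-algebra map `Q → R'`, which extends to `L ⊗ Q` and
there sends the class of `X` to `c`. -/
lemma eval₂_eq_zero_of_aeval_one_tmul (hq : Function.Surjective q) {P : L[X]}
    (hP : aeval ((1 : L) ⊗ₜ[R] q X) P = 0) {R' : Type u} [CommRing R']
    (θ : L →+* R') (c : R') (h : ∀ f, q f = 0 → f.eval₂ (θ.comp (algebraMap R L)) c = 0) :
    P.eval₂ θ c = 0 := by
  algebraize [θ, θ.comp (algebraMap R L)]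
  let F₀ : Q →ₐ[R] R' := AlgHom.liftOfSurjective q hq (aeval c) h
  let F : L ⊗[R] Q →ₐ[L] R' := Algebra.TensorProduct.lift (Algebra.ofId L R') F₀
    (fun _ _ => Commute.all _ _)
  have hF : F (1 ⊗ₜ q X) = c := by
    refine (Algebra.TensorProduct.lift_tmul ..).trans ?_
    rw [map_one, one_mul]
    exact (AlgHom.liftOfSurjective_apply q hq (aeval c) h X).trans (aeval_X c)
  have h0 := congrArg F hP
  rw [← aeval_algHom_apply, hF, map_zero] at h0
  exact h0

variable [Module.Finite R Q]

lemma exists_monic_of_free_tensor (hq : Function.Surjective q) [Module.Free L (L ⊗[R] Q)] :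
    ∃ P : L[X], P.Monic ∧ ∀ ⦃R' : Type u⦄ [CommRing R'] (θ : L →+* R') (c : R'),
      (∀ f, q f = 0 → f.eval₂ (θ.comp (algebraMap R L)) c = 0) ↔ P.eval₂ θ c = 0 := by
  obtain ⟨P, hP, hPf⟩ := exists_monic_forall_aeval_eq_zero_iff _ (aeval_one_tmul_surjective L hq)
  refine ⟨P, hP, fun R' _ θ c =>
    ⟨eval₂_eq_zero_of_aeval_one_tmul hq ((hPf P).2 dvd_rfl) θ c, fun h f hf => ?_⟩⟩
  have h1 : P ∣ f.map (algebraMap R L) := by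
    rw [← hPf, aeval_one_tmul, hf, TensorProduct.tmul_zero]
  obtain ⟨g, hg⟩ := h1
  have h2 := congrArg (eval₂ θ c) hg
  rwa [eval₂_mul, h, zero_mul, eval₂_map] at h2

/-- A finite flat closed subscheme of the affine line over a noetherian affine base is locally
the zero locus of a monic polynomial. -/
lemma exists_local_monic (hq : Function.Surjective q) [IsNoetherianRing R] [Module.Flat R Q]
    (p : PrimeSpectrum R) :
    ∃ r ∉ p.asIdeal, ∀ ⦃R' : Type u⦄ [CommRing R'] (ψ : R →+* R'), IsUnit (ψ r) →
      ∃ P : R'[X], P.Monic ∧ ∀ ⦃R'' : Type u⦄ [CommRing R''] (θ : R' →+* R'') (c : R''),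
        (∀ f, q f = 0 → f.eval₂ (θ.comp ψ) c = 0) ↔ P.eval₂ θ c = 0 := by
  have : Module.FinitePresentation R Q := Module.finitePresentation_of_finite _ _
  -- A finitely presented flat module is free near every point.
  have hfree : p ∈ Module.freeLocus R Q := by
    rw [Module.freeLocus_eq_univ]; trivial
  rw [Module.mem_freeLocus] at hfree
  obtain ⟨r, hr, hfr, -⟩ := Module.FinitePresentation.exists_free_localizedModule_powers
    p.asIdeal.primeCompl (LocalizedModule.mkLinearMap p.asIdeal.primeCompl Q)
    (Localization.AtPrime p.asIdeal)
  have : Module.Free (Localization.Away r) (Localization.Away r ⊗[R] Q) :=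
    Module.Free.of_equiv (LocalizedModule.equivTensorProduct (Submonoid.powers r) Q)
  obtain ⟨P, hP, hPf⟩ := exists_monic_of_free_tensor (L := Localization.Away r) hq
  refine ⟨r, hr, fun R' _ ψ hu => ?_⟩
  have hψ' := IsLocalization.Away.lift_comp (S := Localization.Away r) r hu
  refine ⟨P.map (IsLocalization.Away.lift r hu), hP.map _, fun R'' _ θ c => ?_⟩
  rw [eval₂_map, ← hPf, RingHom.comp_assoc, hψ']

end

end

end AdditivePolynomial

/-! ### Polynomial expressions of morphisms between line bundles -/

section

open Polynomial

variable {S : Scheme.{u}}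

/-- The `S`-scheme `Spec R'` over the affine `S`-scheme `T` given by an algebra `R'` over the
functions on `T`. -/
noncomputable def specOver (T : Over S) [IsAffine T.left] {R' : Type u} [CommRing R']
    (φ : Γ(T.left, ⊤) →+* R') : Over S :=
  Over.mk (Spec.map (CommRingCat.ofHom φ) ≫ T.left.isoSpec.inv ≫ T.hom)

section

variable (T : Over S) [IsAffine T.left] {R' : Type u} [CommRing R'] (φ : Γ(T.left, ⊤) →+* R')

noncomputable def specOverProj : specOver T φ ⟶ T :=
  Over.homMk (Spec.map (CommRingCat.ofHom φ) ≫ T.left.isoSpec.inv) (by simp [specOver])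

noncomputable def specOverEquiv : R' ≃+* Γ((specOver T φ).left, ⊤) :=
  (Scheme.ΓSpecIso (CommRingCat.of R')).commRingCatIsoToRingEquiv.symm

instance : IsAffine (specOver T φ).left :=
  inferInstanceAs (IsAffine (Spec (CommRingCat.of R')))

lemma specOverProj_appTop (x : Γ(T.left, ⊤)) :
    (specOverProj T φ).left.appTop.hom x = specOverEquiv T φ (φ x) := by
  change (Spec.map (CommRingCat.ofHom φ) ≫ T.left.isoSpec.inv).appTop x =
    (CommRingCat.ofHom φ ≫ (Scheme.ΓSpecIso (CommRingCat.of R')).inv) x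
  congr 2
  refine Eq.trans ?_ (Scheme.ΓSpecIso_inv_naturality (CommRingCat.ofHom φ)).symm
  rw [Scheme.Hom.comp_appTop]
  congr 1
  have h := Scheme.toSpecΓ_appTop T.left
  rw [← Scheme.isoSpec_hom] at h
  rw [← Category.id_comp T.left.isoSpec.inv.appTop, ← (Scheme.ΓSpecIso _).inv_hom_id,
    Category.assoc, ← h, ← Scheme.Hom.comp_appTop, Iso.inv_hom_id, Scheme.Hom.id_appTop]
  exact Category.comp_id _

variable {T φ}

lemma specOver_hom_ext {Y : Over S} {k k' : Y ⟶ specOver T φ}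
    (h : ∀ x, k.left.appTop.hom (specOverEquiv T φ x) =
      k'.left.appTop.hom (specOverEquiv T φ x)) : k = k' := by
  apply Over.OverMorphism.ext
  apply ext_of_isAffine
  ext x
  obtain ⟨y, rfl⟩ := (specOverEquiv T φ).surjective x
  exact h y

lemma exists_hom_specOver {Y : Over S} (h : Y ⟶ T) (ψ : R' →+* Γ(Y.left, ⊤))
    (hψ : ∀ x, ψ (φ x) = h.left.appTop.hom x) :
    ∃ k : Y ⟶ specOver T φ, k ≫ specOverProj T φ = h ∧
      ∀ x, k.left.appTop.hom (specOverEquiv T φ x) = ψ x := by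
  have e : CommRingCat.ofHom φ ≫ CommRingCat.ofHom ψ = h.left.appTop := by
    ext x; exact hψ x
  have h1 : (Y.left.toSpecΓ ≫ Spec.map (CommRingCat.ofHom ψ)) ≫
      Spec.map (CommRingCat.ofHom φ) ≫ T.left.isoSpec.inv = h.left := by
    rw [Category.assoc, ← Spec.map_comp_assoc, e, ← Scheme.toSpecΓ_naturality_assoc]
    simp [← Scheme.isoSpec_hom]
  refine ⟨Over.homMk (Y.left.toSpecΓ ≫ Spec.map (CommRingCat.ofHom ψ)) ?_, ?_, fun x => ?_⟩
  · change (Y.left.toSpecΓ ≫ Spec.map (CommRingCat.ofHom ψ)) ≫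
      Spec.map (CommRingCat.ofHom φ) ≫ T.left.isoSpec.inv ≫ T.hom = _
    rw [← Over.w h, ← h1]
    simp only [Category.assoc]
  · apply Over.OverMorphism.ext
    exact h1
  · change ((Scheme.ΓSpecIso (CommRingCat.of R')).inv ≫
      (Y.left.toSpecΓ ≫ Spec.map (CommRingCat.ofHom ψ)).appTop) x = CommRingCat.ofHom ψ x
    congr 2
    rw [Scheme.Hom.comp_appTop, ← Scheme.ΓSpecIso_inv_naturality_assoc, Scheme.toSpecΓ_appTop]
    simp

end

namespace LineBundle

variable {V W W' : LineBundle S}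

/-- The section `b` over `T` is a basis of the restriction of the line bundle to `T`. -/
def IsBasis {T : Over S} (b : T ⟶ V.total) : Prop :=
  ∀ (T' : Over S) (g : T' ⟶ T), Function.Bijective fun c : Γ(T'.left, ⊤) => c • (g ≫ b)

lemma IsBasis.comp {T T' : Over S} {b : T ⟶ V.total} (hb : IsBasis b) (g : T' ⟶ T) :
    IsBasis (g ≫ b) := fun T'' g' => by
  simpa only [Category.assoc] using hb T'' (g' ≫ g)

lemma IsBasis.smul_injective {T T' : Over S} {b : T ⟶ V.total} (hb : IsBasis b) (g : T' ⟶ T)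
    {c d : Γ(T'.left, ⊤)} (h : c • (g ≫ b) = d • (g ≫ b)) : c = d :=
  (hb T' g).1 h

lemma IsBasis.exists_smul {T T' : Over S} {b : T ⟶ V.total} (hb : IsBasis b) (g : T' ⟶ T)
    (x : T' ⟶ V.total) : ∃ c : Γ(T'.left, ⊤), x = c • (g ≫ b) :=
  let ⟨c, hc⟩ := (hb T' g).2 x
  ⟨c, hc.symm⟩

lemma IsBasis.exists_unit {T : Over S} {b b' : T ⟶ V.total} (hb : IsBasis b) (hb' : IsBasis b') :
    ∃ u : Γ(T.left, ⊤)ˣ, b = (u : Γ(T.left, ⊤)) • b' := by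
  obtain ⟨u, hu⟩ := hb'.exists_smul (𝟙 T) b
  obtain ⟨v, hv⟩ := hb.exists_smul (𝟙 T) b'
  rw [Category.id_comp] at hu hv
  have h1 : u * v = 1 := hb'.smul_injective (𝟙 T) (by
    rw [Category.id_comp, one_smul, mul_comm, mul_smul, ← hu, ← hv])
  exact ⟨⟨u, v, h1, by rw [mul_comm, h1]⟩, hu⟩

/-- With respect to the sections `b`, `b'` over `T`, the morphism `f` is the polynomial map `P`. -/
def LocalExpr (f : V.total ⟶ W.total) {T : Over S} (b : T ⟶ V.total) (b' : T ⟶ W.total)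
    (P : Γ(T.left, ⊤)[X]) : Prop :=
  ∀ (T' : Over S) (g : T' ⟶ T) (c : Γ(T'.left, ⊤)),
    (c • (g ≫ b)) ≫ f = P.eval₂ g.left.appTop.hom c • (g ≫ b')

lemma LocalExpr.restrict {f : V.total ⟶ W.total} {T : Over S} {b : T ⟶ V.total}
    {b' : T ⟶ W.total} {P : Γ(T.left, ⊤)[X]} (h : LocalExpr f b b' P) {T' : Over S}
    (g : T' ⟶ T) : LocalExpr f (g ≫ b) (g ≫ b') (P.map g.left.appTop.hom) :=
  fun T'' g' c => by
    rw [eval₂_map, ← Category.assoc, h T'' (g' ≫ g) c, Over.comp_left, Scheme.Hom.comp_appTop,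
      CommRingCat.hom_comp, Category.assoc]

lemma LocalExpr.comp {f : V.total ⟶ W.total} {f' : W.total ⟶ W'.total} {T : Over S}
    {b : T ⟶ V.total} {b' : T ⟶ W.total} {b'' : T ⟶ W'.total} {P Q : Γ(T.left, ⊤)[X]}
    (h : LocalExpr f b b' P) (h' : LocalExpr f' b' b'' Q) :
    LocalExpr (f ≫ f') b b'' (Q.comp P) := fun T' g c => by
  rw [← Category.assoc, h T' g c, h' T' g, eval₂_comp]

lemma LocalExpr.smul {f : V.total ⟶ W.total} {T : Over S} {b : T ⟶ V.total}
    {b' : T ⟶ W.total} {P : Γ(T.left, ⊤)[X]} (h : LocalExpr f b b' P)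
    (u : Γ(T.left, ⊤)) : LocalExpr f (u • b) b' (P.comp (C u * X)) := fun T' g c => by
  rw [comp_smul, smul_smul, h T' g, eval₂_comp, eval₂_mul, eval₂_C, eval₂_X, mul_comm]

lemma LocalExpr.mul_left {f : V.total ⟶ W.total} {T : Over S} {b : T ⟶ V.total}
    {b' : T ⟶ W.total} {P : Γ(T.left, ⊤)[X]} {u : Γ(T.left, ⊤)}
    (h : LocalExpr f b (u • b') P) : LocalExpr f b b' (C u * P) := fun T' g c => by
  rw [h T' g, comp_smul, smul_smul, eval₂_mul, eval₂_C, mul_comm]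

section Affine

variable {T : Over S} [IsAffine T.left]

/-- Polynomials over the functions on `T` are determined by their values on `T`-schemes. -/
lemma eq_of_forall_eval₂ {P Q : Γ(T.left, ⊤)[X]}
    (h : ∀ (T' : Over S) (g : T' ⟶ T) (c : Γ(T'.left, ⊤)),
      P.eval₂ g.left.appTop.hom c = Q.eval₂ g.left.appTop.hom c) : P = Q := by
  -- Evaluation at the universal point `X` of the affine line.
  let φ : Γ(T.left, ⊤) →+* Γ(T.left, ⊤)[X] := C
  have e : (specOverProj T φ).left.appTop.hom = (specOverEquiv T φ).toRingHom.comp φ := by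
    ext x; exact specOverProj_appTop T φ x
  have h1 := h _ (specOverProj T φ) (specOverEquiv T φ X)
  rw [e] at h1
  have e2 (F : Γ(T.left, ⊤)[X]) : F.eval₂ ((specOverEquiv T φ).toRingHom.comp φ)
      (specOverEquiv T φ X) = specOverEquiv T φ F := by
    have := hom_eval₂ F φ (specOverEquiv T φ).toRingHom X
    rw [eval₂_C_X] at this
    exact this.symm
  rw [e2, e2] at h1
  exact (specOverEquiv T φ).injective h1

lemma dvd_of_forall_eval₂ {P Q : Γ(T.left, ⊤)[X]}
    (h : ∀ (T' : Over S) (g : T' ⟶ T) (c : Γ(T'.left, ⊤)),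
      P.eval₂ g.left.appTop.hom c = 0 → Q.eval₂ g.left.appTop.hom c = 0) : P ∣ Q := by
  -- The test object is the zero scheme of `P` with its tautological zero.
  let φ := AdjoinRoot.of P
  have e : (specOverProj T φ).left.appTop.hom = (specOverEquiv T φ).toRingHom.comp φ := by
    ext x; exact specOverProj_appTop T φ x
  have h1 := h _ (specOverProj T φ) (specOverEquiv T φ (AdjoinRoot.root P))
  rw [e] at h1
  have e2 (F : Γ(T.left, ⊤)[X]) : F.eval₂ ((specOverEquiv T φ).toRingHom.comp φ)
      (specOverEquiv T φ (AdjoinRoot.root P)) = specOverEquiv T φ (AdjoinRoot.mk P F) := by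
    have := hom_eval₂ F φ (specOverEquiv T φ).toRingHom (AdjoinRoot.root P)
    rw [← AdjoinRoot.aeval_eq]
    exact this.symm
  rw [e2, e2, AdjoinRoot.mk_self, map_zero] at h1
  rw [← AdjoinRoot.mk_eq_zero]
  exact (specOverEquiv T φ).injective (by rw [h1 rfl, map_zero])

lemma LocalExpr.unique {f : V.total ⟶ W.total} {b : T ⟶ V.total} {b' : T ⟶ W.total}
    (hb' : IsBasis b') {P Q : Γ(T.left, ⊤)[X]} (hP : LocalExpr f b b' P)
    (hQ : LocalExpr f b b' Q) : P = Q :=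
  eq_of_forall_eval₂ fun T' g c => hb'.smul_injective g (by rw [← hP T' g c, ← hQ T' g c])

/-- Yoneda: the image of the universal section over the affine line over `T` has a coordinate in
`Γ(T)[X]`. This coordinate is `P`, and every other section is a pullback of the universal one. -/
lemma exists_localExpr (f : V.total ⟶ W.total) (b : T ⟶ V.total) {b' : T ⟶ W.total}
    (hb' : IsBasis b') : ∃ P : Γ(T.left, ⊤)[X], LocalExpr f b b' P := by
  let φ : Γ(T.left, ⊤) →+* Γ(T.left, ⊤)[X] := C
  obtain ⟨c, hc⟩ := hb'.exists_smul (specOverProj T φ)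
    ((specOverEquiv T φ X • (specOverProj T φ ≫ b)) ≫ f)
  obtain ⟨P, rfl⟩ := (specOverEquiv T φ).surjective c
  refine ⟨P, fun T' g c => ?_⟩
  obtain ⟨k, hk, hk'⟩ := exists_hom_specOver (φ := φ) g (eval₂RingHom g.left.appTop.hom c)
    (fun x => eval₂_C _ _)
  have h1 := congrArg (k ≫ ·) hc
  simp only [comp_smul, ← Category.assoc, hk, hk'] at h1
  simpa using h1

end Affine

end LineBundle

end

/-! ### Gluing over an open cover of the base -/

section

open Polynomial

variable {S : Scheme.{u}}

/-- The open subscheme `U` of `S` as an `S`-scheme. -/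
noncomputable abbrev opensOver (U : S.Opens) : Over S := Over.mk U.ι

lemma opensOver_hom_subsingleton {T : Over S} {U : S.Opens} (g g' : T ⟶ opensOver U) : g = g' := by
  apply Over.OverMorphism.ext
  rw [← cancel_mono U.ι]
  exact (Over.w g).trans (Over.w g').symm

lemma exists_hom_opensOver {T : Over S} {U : S.Opens} (h : ∀ x, T.hom x ∈ U) :
    Nonempty (T ⟶ opensOver U) := by
  have hr : Set.range T.hom ⊆ Set.range U.ι := by
    rintro _ ⟨x, rfl⟩
    simpa using h x
  exact ⟨Over.homMk (IsOpenImmersion.lift U.ι T.hom hr) (IsOpenImmersion.lift_fac _ _ _)⟩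

lemma hom_mem_of_hom_opensOver {T : Over S} {U : S.Opens} (g : T ⟶ opensOver U) (x : T.left) :
    T.hom x ∈ U := by
  rw [← Over.w g]
  exact (g.left x).2

/-- The restriction of the `S`-scheme `T` to the open subset `U` of `S`. -/
noncomputable def restrictOver (T : Over S) (U : S.Opens) : Over S :=
  Over.mk ((T.hom ⁻¹ᵁ U).ι ≫ T.hom)

noncomputable def restrictIncl (T : Over S) (U : S.Opens) : restrictOver T U ⟶ T :=
  Over.homMk (T.hom ⁻¹ᵁ U).ι rfl

instance (T : Over S) (U : S.Opens) : IsOpenImmersion (restrictIncl T U).left :=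
  inferInstanceAs (IsOpenImmersion (T.hom ⁻¹ᵁ U).ι)

noncomputable def restrictProj (T : Over S) (U : S.Opens) : restrictOver T U ⟶ opensOver U :=
  Over.homMk (T.hom ∣_ U) (morphismRestrict_ι _ _)

lemma exists_hom_restrictOver {T Z : Over S} {U : S.Opens} (z : T ⟶ Z) (g : T ⟶ opensOver U) :
    ∃ k : T ⟶ restrictOver Z U, k ≫ restrictIncl Z U = z := by
  have hr : Set.range z.left ⊆ Set.range (restrictIncl Z U).left := by
    rintro _ ⟨x, rfl⟩
    refine ⟨⟨z.left x, ?_⟩, rfl⟩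
    change Z.hom (z.left x) ∈ U
    rw [← Scheme.Hom.comp_apply, Over.w z]
    exact hom_mem_of_hom_opensOver g x
  have hf := IsOpenImmersion.lift_fac (restrictIncl Z U).left z.left hr
  refine ⟨Over.homMk (IsOpenImmersion.lift (restrictIncl Z U).left z.left hr) ?_, ?_⟩
  · change _ ≫ (restrictIncl Z U).left ≫ Z.hom = _
    rw [← Category.assoc, hf, Over.w z]
  · exact Over.OverMorphism.ext hf

section Cover

variable {ι : Type u} {U : ι → S.Opens}

/-- The open cover of an `S`-scheme induced by an open cover of `S`. -/
noncomputable def restrictCover (hU : ∀ s, ∃ i, s ∈ U i) (T : Over S) : T.left.OpenCover :=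
  T.left.openCoverOfIsOpenCover (fun i => T.hom ⁻¹ᵁ U i) (by
    refine top_le_iff.1 fun x _ => ?_
    rw [TopologicalSpace.Opens.mem_iSup]
    exact hU (T.hom x))

lemma over_hom_ext (hU : ∀ s, ∃ i, s ∈ U i) {T Z : Over S} {x y : T ⟶ Z}
    (h : ∀ (i : ι) (T' : Over S) (g : T' ⟶ T), (T' ⟶ opensOver (U i)) → g ≫ x = g ≫ y) :
    x = y := by
  apply Over.OverMorphism.ext
  refine (restrictCover hU T).hom_ext _ _ fun i => ?_
  exact congrArg (fun k => k.left) (h i _ (restrictIncl T (U i)) (restrictProj T (U i)))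

lemma appTop_ext (hU : ∀ s, ∃ i, s ∈ U i) {T : Over S} {x y : Γ(T.left, ⊤)}
    (h : ∀ (i : ι) (T' : Over S) (g : T' ⟶ T), (T' ⟶ opensOver (U i)) →
      g.left.appTop.hom x = g.left.appTop.hom y) : x = y :=
  (restrictCover hU T).ext_elem _ _ fun i =>
    h i _ (restrictIncl T (U i)) (restrictProj T (U i))

lemma over_hom_ext_of_isAffine {T Z : Over S} {x y : T ⟶ Z}
    (h : ∀ (T' : Over S) (g : T' ⟶ T), IsAffine T'.left → g ≫ x = g ≫ y) : x = y := by
  apply Over.OverMorphism.ext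
  refine T.left.affineCover.hom_ext _ _ fun i => ?_
  exact congrArg (fun k => k.left) (h (Over.mk (T.left.affineCover.f i ≫ T.hom))
    (Over.homMk (T.left.affineCover.f i) rfl)
    (inferInstanceAs (IsAffine (T.left.affineCover.X i))))

lemma exists_glue (hU : ∀ s, ∃ i, s ∈ U i) {T Z : Over S}
    (y : ∀ i, restrictOver T (U i) ⟶ Z)
    (h : ∀ (i j : ι) (T' : Over S) (g : T' ⟶ restrictOver T (U i))
      (g' : T' ⟶ restrictOver T (U j)), IsAffine T'.left →
      g ≫ restrictIncl T (U i) = g' ≫ restrictIncl T (U j) → g ≫ y i = g' ≫ y j) :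
    ∃ x : T ⟶ Z, ∀ i, restrictIncl T (U i) ≫ x = y i := by
  let 𝒰 := restrictCover hU T
  have hc (i j : ι) : Limits.pullback.fst (𝒰.f i) (𝒰.f j) ≫ (y i).left =
      Limits.pullback.snd (𝒰.f i) (𝒰.f j) ≫ (y j).left := by
    let T' : Over S := Over.mk (Limits.pullback.fst (𝒰.f i) (𝒰.f j) ≫ 𝒰.f i ≫ T.hom)
    let g : T' ⟶ restrictOver T (U i) := Over.homMk (Limits.pullback.fst (𝒰.f i) (𝒰.f j)) rfl
    let g' : T' ⟶ restrictOver T (U j) := Over.homMk (Limits.pullback.snd (𝒰.f i) (𝒰.f j)) (by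
      change _ ≫ 𝒰.f j ≫ T.hom = _ ≫ 𝒰.f i ≫ T.hom
      rw [Limits.pullback.condition_assoc])
    have hg : g ≫ y i = g' ≫ y j := by
      refine over_hom_ext_of_isAffine fun T'' k hk => ?_
      rw [← Category.assoc, ← Category.assoc]
      refine h i j T'' _ _ hk ?_
      rw [Category.assoc, Category.assoc]
      congr 1
      apply Over.OverMorphism.ext
      exact Limits.pullback.condition
    exact congrArg (fun k => k.left) hg
  have hι := 𝒰.ι_glueMorphisms (fun i => (y i).left) hc
  refine ⟨Over.homMk (𝒰.glueMorphisms (fun i => (y i).left) hc) ?_, fun i => ?_⟩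
  · refine 𝒰.hom_ext _ _ fun i => ?_
    rw [← Category.assoc, hι]
    exact Over.w (y i)
  · apply Over.OverMorphism.ext
    exact hι i

end Cover

namespace LineBundle

variable {V W : LineBundle S}

/-- Gluing of a morphism of line bundles from compatible local expressions. -/
theorem exists_hom_of_localExpr {ι : Type u} {U : ι → S.Opens} (hU : ∀ s, ∃ i, s ∈ U i)
    (e : ∀ i, opensOver (U i) ⟶ V.total) (he : ∀ i, IsBasis (e i))
    (e' : ∀ i, opensOver (U i) ⟶ W.total) (P : ∀ i, Γ(U i, ⊤)[X])
    (h : ∀ (i j : ι) (T : Over S) (g : T ⟶ opensOver (U i)) (g' : T ⟶ opensOver (U j))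
      (c c' : Γ(T.left, ⊤)), IsAffine T.left → c • (g ≫ e i) = c' • (g' ≫ e j) →
      (P i).eval₂ g.left.appTop.hom c • (g ≫ e' i) =
        (P j).eval₂ g'.left.appTop.hom c' • (g' ≫ e' j)) :
    ∃ f : V.total ⟶ W.total, ∀ i, LocalExpr f (e i) (e' i) (P i) := by
  -- `c i` is the tautological coordinate on the part of the total space over `U i`.
  choose c hc using fun i => (he i).exists_smul (restrictProj V.total (U i))
    (restrictIncl V.total (U i))
  have key (i : ι) {T : Over S} (g : T ⟶ restrictOver V.total (U i)) :
      g ≫ ((P i).eval₂ (restrictProj V.total (U i)).left.appTop.hom (c i) •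
        (restrictProj V.total (U i) ≫ e' i)) =
      (P i).eval₂ (g ≫ restrictProj V.total (U i)).left.appTop.hom (g.left.appTop.hom (c i)) •
        ((g ≫ restrictProj V.total (U i)) ≫ e' i) := by
    rw [comp_smul, hom_eval₂, Over.comp_left, Scheme.Hom.comp_appTop, CommRingCat.hom_comp,
      Category.assoc]
  obtain ⟨f, hf⟩ := exists_glue hU (fun i =>
    (P i).eval₂ (restrictProj V.total (U i)).left.appTop.hom (c i) •
      (restrictProj V.total (U i) ≫ e' i)) (fun i j T g g' hT hg => by
    rw [key, key]
    refine h i j T _ _ _ _ hT ?_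
    rw [hc, hc] at hg
    simpa only [comp_smul, Category.assoc] using hg)
  refine ⟨f, fun i T g d => ?_⟩
  obtain ⟨k, hk⟩ := exists_hom_restrictOver (d • (g ≫ e i)) g
  have h1 := key i k
  rw [← hf, ← Category.assoc, hk, opensOver_hom_subsingleton (k ≫ restrictProj _ _) g] at h1
  rw [h1]
  congr 2
  rw [hc, comp_smul, ← Category.assoc, opensOver_hom_subsingleton (k ≫ restrictProj _ _) g] at hk
  exact (he i).smul_injective g hk

end LineBundle

end

/-! ### Affine charts on total spaces -/

section

open Polynomial

variable {S : Scheme.{u}}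

namespace LineBundle

variable {V W : LineBundle S}

section

variable (T : Over S) [IsAffine T.left]

/-- The affine line over the affine `S`-scheme `T`. -/
noncomputable abbrev lineOver : Over S := specOver T (C : Γ(T.left, ⊤) →+* Γ(T.left, ⊤)[X])

noncomputable abbrev lineProj : lineOver T ⟶ T := specOverProj T C

noncomputable abbrev lineEquiv : Γ(T.left, ⊤)[X] ≃+* Γ((lineOver T).left, ⊤) := specOverEquiv T C

variable {T}

lemma lineProj_eval₂ (F : Γ(T.left, ⊤)[X]) (Q : Γ(T.left, ⊤)[X]) :
    F.eval₂ (lineProj T).left.appTop.hom (lineEquiv T Q) = lineEquiv T (F.comp Q) := by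
  have e : (lineProj T).left.appTop.hom = (lineEquiv T).toRingHom.comp C := by
    ext x; exact specOverProj_appTop T C x
  rw [e]
  exact (hom_eval₂ F C (lineEquiv T).toRingHom Q).symm

/-- The parametrization of a line bundle over `T` by the affine line given by a section. -/
noncomputable def param (b : T ⟶ V.total) : lineOver T ⟶ V.total :=
  lineEquiv T X • (lineProj T ≫ b)

lemma exists_comp_param (b : T ⟶ V.total) {Y : Over S} (g : Y ⟶ T) (c : Γ(Y.left, ⊤)) :
    ∃ k : Y ⟶ lineOver T, k ≫ lineProj T = g ∧ k ≫ param b = c • (g ≫ b) ∧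
      ∀ F, k.left.appTop.hom (lineEquiv T F) = F.eval₂ g.left.appTop.hom c := by
  obtain ⟨k, hk, hk'⟩ := exists_hom_specOver (φ := C) g (eval₂RingHom g.left.appTop.hom c)
    (fun x => eval₂_C _ _)
  refine ⟨k, hk, ?_, hk'⟩
  rw [param, comp_smul, hk', ← Category.assoc, hk]
  simp

lemma comp_param (b : T ⟶ V.total) {Y : Over S} (k : Y ⟶ lineOver T) :
    k ≫ param b = k.left.appTop.hom (lineEquiv T X) • ((k ≫ lineProj T) ≫ b) := by
  rw [param, comp_smul, Category.assoc]

lemma line_hom_ext {Y : Over S} {k k' : Y ⟶ lineOver T} (h : k ≫ lineProj T = k' ≫ lineProj T)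
    (hX : k.left.appTop.hom (lineEquiv T X) = k'.left.appTop.hom (lineEquiv T X)) : k = k' := by
  refine specOver_hom_ext fun F => ?_
  have e (k : Y ⟶ lineOver T) : k.left.appTop.hom (lineEquiv T F) =
      F.eval₂ (k ≫ lineProj T).left.appTop.hom (k.left.appTop.hom (lineEquiv T X)) := by
    rw [Over.comp_left, Scheme.Hom.comp_appTop, CommRingCat.hom_comp, ← hom_eval₂,
      lineProj_eval₂, comp_X]
  rw [e, e, h, hX]

/-- Over `T`, a section with values in the bundle is the same as its coordinate, so the affine line
over `T` represents the restricted bundle. -/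
lemma isPullback_param {b : T ⟶ V.total} (hb : IsBasis b) :
    IsPullback (param b).left (lineProj T).left V.total.hom T.hom := by
  refine ⟨⟨(Over.w _).trans (Over.w _).symm⟩, ⟨Limits.PullbackCone.isLimitAux' _ fun s => ?_⟩⟩
  apply Classical.choice
  let Y : Over S := Over.mk (s.snd ≫ T.hom)
  let z : Y ⟶ V.total := Over.homMk s.fst s.condition
  let g : Y ⟶ T := Over.homMk s.snd rfl
  obtain ⟨c, hc⟩ := hb.exists_smul g z
  obtain ⟨k, hk, hk', -⟩ := exists_comp_param b g c
  refine ⟨k.left, ?_, congrArg (fun k => k.left) hk, fun {m} hm1 hm2 => ?_⟩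
  · exact congrArg (fun k => k.left) (hk'.trans hc.symm)
  · let m' : Y ⟶ lineOver T := Over.homMk m (by
      refine (congrArg (m ≫ ·) (Over.w (lineProj T)).symm).trans ?_
      exact (Category.assoc _ _ _).symm.trans (congrArg (· ≫ T.hom) hm2))
    have h2 : m' ≫ lineProj T = g := Over.OverMorphism.ext hm2
    have h1 : m' ≫ param b = z := Over.OverMorphism.ext hm1
    have : m' = k := by
      refine line_hom_ext (h2.trans hk.symm) (hb.smul_injective g ?_)
      have e1 := comp_param b m'
      have e2 := comp_param b k
      rw [h2] at e1
      rw [hk] at e2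
      rw [← e1, ← e2, h1, hk', hc]
    exact congrArg (fun k => k.left) this

/-- The morphism `c ↦ Q(c)` of the affine line. -/
noncomputable def lineMap (Q : Γ(T.left, ⊤)[X]) : lineOver T ⟶ lineOver T :=
  Over.homMk (Spec.map (CommRingCat.ofHom (compRingHom Q))) (by
    change Spec.map _ ≫ Spec.map _ ≫ _ = Spec.map _ ≫ _
    rw [← Spec.map_comp_assoc]
    congr 2
    ext x
    simp)

lemma lineMap_proj (Q : Γ(T.left, ⊤)[X]) : lineMap Q ≫ lineProj T = lineProj T := by
  apply Over.OverMorphism.ext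
  change Spec.map _ ≫ Spec.map _ ≫ _ = Spec.map _ ≫ _
  rw [← Spec.map_comp_assoc]
  congr 2
  ext x
  simp

lemma lineMap_appTop (Q F : Γ(T.left, ⊤)[X]) :
    (lineMap Q).left.appTop.hom (lineEquiv T F) = lineEquiv T (F.comp Q) := by
  change ((Scheme.ΓSpecIso _).inv ≫ (Spec.map (CommRingCat.ofHom (compRingHom Q))).appTop) F =
    (CommRingCat.ofHom (compRingHom Q) ≫ (Scheme.ΓSpecIso _).inv) F
  rw [Scheme.ΓSpecIso_inv_naturality]

/-- Makes `c ↦ Q(c)` a base change of `f`, so finiteness, flatness and rank can be transferred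
between `f` and the ring map `X ↦ Q`. -/
lemma LocalExpr.isPullback {f : V.total ⟶ W.total} {b : T ⟶ V.total} {b' : T ⟶ W.total}
    {Q : Γ(T.left, ⊤)[X]} (h : LocalExpr f b b' Q) (hb : IsBasis b) (hb' : IsBasis b') :
    IsPullback (param b).left (lineMap Q).left f.left (param b').left := by
  have hcomm : param b ≫ f = lineMap Q ≫ param b' := by
    rw [comp_param, lineMap_appTop, lineMap_proj, X_comp, param, h, lineProj_eval₂, comp_X]
  refine IsPullback.of_bot (v₂₁ := (lineProj T).left) (v₂₂ := W.total.hom) (h₃₁ := T.hom)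
    ?_ (congrArg (fun k => k.left) hcomm) (isPullback_param hb')
  rw [← Over.comp_left, lineMap_proj, Over.w f]
  exact isPullback_param hb

lemma lineMap_finite_iff {Q : Γ(T.left, ⊤)[X]} :
    IsFinite (lineMap Q).left ↔ (compRingHom Q).Finite :=
  IsFinite.SpecMap_iff (CommRingCat.ofHom (compRingHom Q))

lemma lineMap_flat_iff {Q : Γ(T.left, ⊤)[X]} :
    Flat (lineMap Q).left ↔ (compRingHom Q).Flat :=
  Flat.SpecMap_iff (f := CommRingCat.ofHom (compRingHom Q))

lemma lineMap_finrank {Q : Γ(T.left, ⊤)[X]} (hQ : (compRingHom Q).Finite)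
    (hQ' : (compRingHom Q).Flat) (x : (lineOver T).left) :
    (lineMap Q).left.finrank x = (compRingHom Q).finrank x :=
  congrFun (Scheme.Hom.finrank_SpecMap_eq_finrank
    (f := CommRingCat.ofHom (compRingHom Q)) hQ hQ') x

lemma LocalExpr.finite {f : V.total ⟶ W.total} {b : T ⟶ V.total} {b' : T ⟶ W.total}
    {Q : Γ(T.left, ⊤)[X]} (h : LocalExpr f b b' Q) (hb : IsBasis b) (hb' : IsBasis b')
    (hf : IsFinite f.left) : (compRingHom Q).Finite :=
  lineMap_finite_iff.1 (MorphismProperty.of_isPullback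
    (P := (@IsFinite : MorphismProperty Scheme.{u})) (h.isPullback hb hb') hf)

lemma LocalExpr.flat {f : V.total ⟶ W.total} {b : T ⟶ V.total} {b' : T ⟶ W.total}
    {Q : Γ(T.left, ⊤)[X]} (h : LocalExpr f b b' Q) (hb : IsBasis b) (hb' : IsBasis b')
    (hf : Flat f.left) : (compRingHom Q).Flat :=
  lineMap_flat_iff.1 (MorphismProperty.of_isPullback
    (P := (@Flat : MorphismProperty Scheme.{u})) (h.isPullback hb hb') hf)

lemma LocalExpr.finrank {f : V.total ⟶ W.total} {b : T ⟶ V.total} {b' : T ⟶ W.total}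
    {Q : Γ(T.left, ⊤)[X]} (h : LocalExpr f b b' Q) (hb : IsBasis b) (hb' : IsBasis b')
    (hf : IsFinite f.left) (hf' : Flat f.left) (x : (lineOver T).left) :
    (compRingHom Q).finrank x = f.left.finrank ((param b').left x) := by
  rw [← Scheme.Hom.finrank_of_isPullback _ _ _ _ (h.isPullback hb hb') x]
  exact (lineMap_finrank (h.finite hb hb' hf) (h.flat hb hb' hf') x).symm

end

section Cover

variable {ι : Type u} {U : ι → S.Opens}

lemma isOpenImmersion_param {U : S.Opens} [IsAffine (opensOver U).left]
    {b : opensOver U ⟶ V.total} (hb : IsBasis b) : IsOpenImmersion (param b).left :=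
  MorphismProperty.of_isPullback (P := @IsOpenImmersion) (isPullback_param hb).flip
    (inferInstanceAs (IsOpenImmersion U.ι))

lemma exists_param_eq {U : S.Opens} [IsAffine (opensOver U).left]
    {b : opensOver U ⟶ V.total} (hb : IsBasis b) (y : V.total.left) (hy : V.total.hom y ∈ U) :
    ∃ x, (param b).left x = y := by
  obtain ⟨x, hx, -⟩ := Scheme.exists_preimage_of_isPullback (isPullback_param hb) y
    (⟨V.total.hom y, hy⟩ : U) rfl
  exact ⟨x, hx⟩

/-- The open cover of the total space of a line bundle by affine lines. -/
noncomputable def paramCover (hU : ∀ s, ∃ i, s ∈ U i) [∀ i, IsAffine (opensOver (U i)).left]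
    {e : ∀ i, opensOver (U i) ⟶ V.total} (he : ∀ i, IsBasis (e i)) : V.total.left.OpenCover where
  I₀ := ι
  X i := (lineOver (opensOver (U i))).left
  f i := (param (e i)).left
  mem₀ := by
    rw [Scheme.presieve₀_mem_precoverage_iff]
    refine ⟨fun y => ?_, fun i => isOpenImmersion_param (he i)⟩
    obtain ⟨i, hi⟩ := hU (V.total.hom y)
    exact ⟨i, exists_param_eq (he i) y hi⟩

lemma of_localExpr {P : MorphismProperty Scheme.{u}} [IsZariskiLocalAtTarget P]
    (hU : ∀ s, ∃ i, s ∈ U i) [∀ i, IsAffine (opensOver (U i)).left]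
    {e : ∀ i, opensOver (U i) ⟶ V.total} (he : ∀ i, IsBasis (e i))
    {e' : ∀ i, opensOver (U i) ⟶ W.total} (he' : ∀ i, IsBasis (e' i))
    {f : V.total ⟶ W.total} {Q : ∀ i, Γ(U i, ⊤)[X]}
    (h : ∀ i, LocalExpr f (e i) (e' i) (Q i))
    (hP : ∀ i, P (lineMap (T := opensOver (U i)) (Q i)).left) : P f.left := by
  refine IsZariskiLocalAtTarget.of_openCover (𝒰 := paramCover hU he') fun (i : ι) => ?_
  have hp := (h i).isPullback (he i) (he' i)
  change P (Limits.pullback.snd f.left (param (e' i)).left)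
  rw [← hp.isoPullback_inv_snd, P.cancel_left_of_respectsIso]
  exact hP i

lemma isZariskiLocalAtTarget_isFinite :
    IsZariskiLocalAtTarget (@IsFinite : MorphismProperty Scheme.{u}) :=
  (HasAffineProperty.iff.1 IsFinite.instHasAffinePropertyAndIsAffineFiniteCarrierObjOppositeOpensCarrierCarrierCommRingCatPresheafOpOpensTopHomAppTop).1

lemma isZariskiLocalAtTarget_flat :
    IsZariskiLocalAtTarget (@Flat : MorphismProperty Scheme.{u}) :=
  (HasAffineProperty.iff.1 (HasRingHomProperty.HasAffineProperty (P := @Flat))).1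

lemma isFinite_of_localExpr
    (hU : ∀ s, ∃ i, s ∈ U i) [∀ i, IsAffine (opensOver (U i)).left]
    {e : ∀ i, opensOver (U i) ⟶ V.total} (he : ∀ i, IsBasis (e i))
    {e' : ∀ i, opensOver (U i) ⟶ W.total} (he' : ∀ i, IsBasis (e' i))
    {f : V.total ⟶ W.total} {Q : ∀ i, Γ(U i, ⊤)[X]}
    (h : ∀ i, LocalExpr f (e i) (e' i) (Q i))
    (hQ : ∀ i, (compRingHom (Q i)).Finite) : IsFinite f.left :=
  haveI := isZariskiLocalAtTarget_isFinite.{u}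
  of_localExpr (P := (@IsFinite : MorphismProperty Scheme.{u})) hU he he' h
    fun i => lineMap_finite_iff.2 (hQ i)

lemma flat_of_localExpr
    (hU : ∀ s, ∃ i, s ∈ U i) [∀ i, IsAffine (opensOver (U i)).left]
    {e : ∀ i, opensOver (U i) ⟶ V.total} (he : ∀ i, IsBasis (e i))
    {e' : ∀ i, opensOver (U i) ⟶ W.total} (he' : ∀ i, IsBasis (e' i))
    {f : V.total ⟶ W.total} {Q : ∀ i, Γ(U i, ⊤)[X]}
    (h : ∀ i, LocalExpr f (e i) (e' i) (Q i))
    (hQ : ∀ i, (compRingHom (Q i)).Flat) : Flat f.left :=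
  haveI := isZariskiLocalAtTarget_flat.{u}
  of_localExpr (P := (@Flat : MorphismProperty Scheme.{u})) hU he he' h
    fun i => lineMap_flat_iff.2 (hQ i)

lemma finrank_of_localExpr
    (hU : ∀ s, ∃ i, s ∈ U i) [∀ i, IsAffine (opensOver (U i)).left]
    {e : ∀ i, opensOver (U i) ⟶ V.total} (he : ∀ i, IsBasis (e i))
    {e' : ∀ i, opensOver (U i) ⟶ W.total} (he' : ∀ i, IsBasis (e' i))
    {f : V.total ⟶ W.total} {Q : ∀ i, Γ(U i, ⊤)[X]}
    (h : ∀ i, LocalExpr f (e i) (e' i) (Q i))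
    (hQ : ∀ i, (compRingHom (Q i)).Finite) (hQ' : ∀ i, (compRingHom (Q i)).Flat) (n : ℕ)
    (hn : ∀ i x, (compRingHom (Q i)).finrank x = n) (y : W.total.left) :
    f.left.finrank y = n := by
  obtain ⟨i, hi⟩ := hU (W.total.hom y)
  obtain ⟨x, rfl⟩ := exists_param_eq (he' i) y hi
  rw [← hn i x]
  exact ((h i).finrank (he i) (he' i) (isFinite_of_localExpr hU he he' h hQ)
    (flat_of_localExpr hU he he' h hQ') x).symm

end Cover

end LineBundle

end

/-! ### Frobenius twists of line bundles -/

section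

open TopologicalSpace Opposite

/-- The iterated Frobenius `x ↦ x ^ p ^ k` of a ring of characteristic `p`. -/
def powCharPowHom {p : ℕ} (hp : p.Prime) (k : ℕ) {R : Type*} [CommRing R] (hR : (p : R) = 0) :
    R →+* R where
  toFun x := x ^ p ^ k
  map_one' := one_pow _
  map_mul' x y := mul_pow x y _
  map_zero' := zero_pow (pow_ne_zero k hp.ne_zero)
  map_add' x y := by
    rcases subsingleton_or_nontrivial R with h | h
    · exact Subsingleton.elim _ _
    · have : Fact p.Prime := ⟨hp⟩
      have : CharP R p := (CharP.charP_iff_prime_eq_zero hp).2 hR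
      exact add_pow_char_pow x y p k

lemma natCast_section_eq_zero {p : ℕ} {X : Scheme.{u}} (hX : (p : Γ(X, ⊤)) = 0) (U : X.Opens) :
    (p : Γ(X, U)) = 0 := by
  rw [← map_natCast (X.presheaf.map (homOfLE (le_top : U ≤ ⊤)).op).hom, hX, map_zero]

lemma natCast_appTop_eq_zero {p : ℕ} {X Y : Scheme.{u}} (f : Y ⟶ X) (hX : (p : Γ(X, ⊤)) = 0) :
    (p : Γ(Y, ⊤)) = 0 := by
  rw [← map_natCast f.appTop.hom, hX, map_zero]

namespace AlgebraicGeometry.Scheme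

variable {p : ℕ} (hp : p.Prime) (k : ℕ)

/-- The underlying morphism of presheafed spaces of the iterated absolute Frobenius. -/
noncomputable def frobeniusPresheafedSpace (X : Scheme.{u}) (hX : (p : Γ(X, ⊤)) = 0) :
    X.toPresheafedSpace.Hom X.toPresheafedSpace where
  base := 𝟙 _
  c :=
    { app := fun U => CommRingCat.ofHom
        (powCharPowHom hp k (natCast_section_eq_zero hX U.unop))
      naturality := fun U V i => by
        ext x
        exact (map_pow (X.presheaf.map i).hom x (p ^ k)).symm }

/-- The iterated absolute Frobenius of a scheme of characteristic `p`. -/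
noncomputable def frobenius (X : Scheme.{u}) (hX : (p : Γ(X, ⊤)) = 0) : X ⟶ X :=
  ⟨⟨frobeniusPresheafedSpace hp k X hX, fun x => ⟨fun a ha => by
    obtain ⟨U, hxU, s, rfl⟩ := TopCat.Presheaf.exists_germ_eq X.presheaf a
    have h : ((frobeniusPresheafedSpace hp k X hX).stalkMap x).hom
        ((X.presheaf.germ U x hxU).hom s) = ((X.presheaf.germ U x hxU).hom s) ^ p ^ k := by
      rw [← map_pow]
      exact congr($(PresheafedSpace.stalkMap_germ
        (frobeniusPresheafedSpace hp k X hX) U x hxU) s)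
    -- On germs the map is a power map with nonzero exponent, so it reflects units.
    refine (isUnit_pow_iff (pow_ne_zero k hp.ne_zero)).1 ?_
    exact h ▸ ha⟩⟩⟩

lemma frobenius_comp {X Y : Scheme.{u}} (f : Y ⟶ X) (hX : (p : Γ(X, ⊤)) = 0) :
    frobenius hp k Y (natCast_appTop_eq_zero f hX) ≫ f = f ≫ frobenius hp k X hX := by
  refine Scheme.Hom.ext rfl fun U => ?_
  ext x
  refine (congr($(Y.presheaf.map_id _) _)).trans ?_
  exact (map_pow (f.app U).hom x (p ^ k)).symm

end AlgebraicGeometry.Scheme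


namespace LineBundle

variable {S : Scheme.{u}} {p : ℕ} (hp : p.Prime) (k : ℕ) (hS : (p : Γ(S, ⊤)) = 0)

/-- The `S`-scheme `T`, with its structure morphism composed with the Frobenius of `S`. -/
noncomputable abbrev frobeniusOver (T : Over S) : Over S :=
  (Over.map (Scheme.frobenius hp k S hS)).obj T

/-- The relative Frobenius. -/
noncomputable def relFrobenius (T : Over S) : frobeniusOver hp k hS T ⟶ T :=
  Over.homMk (Scheme.frobenius hp k T.left (natCast_appTop_eq_zero T.hom hS))
    (Scheme.frobenius_comp hp k T.hom hS)

lemma relFrobenius_naturality {T T' : Over S} (g : T' ⟶ T) :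
    relFrobenius hp k hS T' ≫ g =
      (Over.map (Scheme.frobenius hp k S hS)).map g ≫ relFrobenius hp k hS T :=
  Over.OverMorphism.ext (Scheme.frobenius_comp hp k g.left _)

/-- The total space of the Frobenius twist. -/
noncomputable abbrev twistTotal (V : LineBundle S) : Over S :=
  (Over.pullback (Scheme.frobenius hp k S hS)).obj V.total

/-- A `T`-point of the twist is a point of `V` over the same scheme `T` with structure morphism
composed with Frobenius. The functions on `T` do not change, so the module structure can be
transported. -/
noncomputable def twistEquiv (V : LineBundle S) (T : Over S) :
    (T ⟶ twistTotal hp k hS V) ≃ (frobeniusOver hp k hS T ⟶ V.total) :=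
  ((Over.mapPullbackAdj (Scheme.frobenius hp k S hS)).homEquiv T V.total).symm

lemma twistEquiv_comp (V : LineBundle S) {T T' : Over S} (g : T' ⟶ T)
    (x : T ⟶ twistTotal hp k hS V) :
    twistEquiv hp k hS V T' (g ≫ x) =
      (Over.map (Scheme.frobenius hp k S hS)).map g ≫ twistEquiv hp k hS V T x :=
  Adjunction.homEquiv_naturality_left_symm _ _ _

noncomputable def twistMap (V : LineBundle S) : V.total ⟶ twistTotal hp k hS V :=
  (twistEquiv hp k hS V V.total).symm (relFrobenius hp k hS V.total)

lemma twistEquiv_comp_twistMap (V : LineBundle S) {T : Over S} (x : T ⟶ V.total) :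
    twistEquiv hp k hS V T (x ≫ twistMap hp k hS V) = relFrobenius hp k hS T ≫ x := by
  rw [twistEquiv_comp, twistMap, Equiv.apply_symm_apply, relFrobenius_naturality]

noncomputable instance (V : LineBundle S) (T : Over S) :
    AddCommGroup (T ⟶ twistTotal hp k hS V) :=
  (twistEquiv hp k hS V T).addCommGroup

noncomputable instance (V : LineBundle S) (T : Over S) :
    Module Γ(T.left, ⊤) (T ⟶ twistTotal hp k hS V) :=
  letI : Module Γ(T.left, ⊤) (frobeniusOver hp k hS T ⟶ V.total) :=
    V.module (frobeniusOver hp k hS T)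
  (twistEquiv hp k hS V T).module _

lemma twistEquiv_add (V : LineBundle S) {T : Over S} (x y : T ⟶ twistTotal hp k hS V) :
    twistEquiv hp k hS V T (x + y) = twistEquiv hp k hS V T x + twistEquiv hp k hS V T y :=
  (twistEquiv hp k hS V T).apply_symm_apply _

lemma twistEquiv_smul (V : LineBundle S) {T : Over S} (c : Γ(T.left, ⊤))
    (x : T ⟶ twistTotal hp k hS V) : twistEquiv hp k hS V T (c • x) =
      @HSMul.hSMul Γ((frobeniusOver hp k hS T).left, ⊤) _ _ _ c (twistEquiv hp k hS V T x) :=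
  (twistEquiv hp k hS V T).apply_symm_apply _

/-- Precomposition with Frobenius raises functions to the power `p^k`. Hence rescaling a frame by
`u` rescales the twisted frame by `u^(p^k)`. -/
lemma smul_comp_twistMap (V : LineBundle S) {T : Over S} (c : Γ(T.left, ⊤)) (x : T ⟶ V.total) :
    (c • x) ≫ twistMap hp k hS V = c ^ p ^ k • (x ≫ twistMap hp k hS V) := by
  apply (twistEquiv hp k hS V T).injective
  rw [twistEquiv_smul, twistEquiv_comp_twistMap, twistEquiv_comp_twistMap, comp_smul]
  rfl

lemma twistMap_bijective (V : LineBundle S) {T : Over S} {b : T ⟶ V.total} (hb : IsBasis b)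
    {T' : Over S} (g : T' ⟶ T) : Function.Bijective fun c : Γ(T'.left, ⊤) =>
      c • (g ≫ b ≫ twistMap hp k hS V) := by
  rw [← (twistEquiv hp k hS V T').comp_bijective]
  have h : (twistEquiv hp k hS V T' ∘ fun c : Γ(T'.left, ⊤) => c • (g ≫ b ≫ twistMap hp k hS V)) =
      fun c : Γ((frobeniusOver hp k hS T').left, ⊤) => c • ((relFrobenius hp k hS T' ≫ g) ≫ b) := by
    funext c
    rw [Function.comp_apply, twistEquiv_smul, ← Category.assoc, twistEquiv_comp_twistMap,
      Category.assoc]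
  rw [h]
  exact hb _ _

/-- The iterated Frobenius twist of a line bundle. -/
noncomputable def twist (V : LineBundle S) : LineBundle S where
  total := twistTotal hp k hS V
  addCommGroup := inferInstance
  module := inferInstance
  comp_add g x y := (twistEquiv hp k hS V _).injective <| by
    rw [twistEquiv_comp, twistEquiv_add, comp_add, twistEquiv_add, twistEquiv_comp,
      twistEquiv_comp]
  comp_smul g c x := (twistEquiv hp k hS V _).injective <| by
    rw [twistEquiv_comp, twistEquiv_smul, comp_smul, twistEquiv_smul, twistEquiv_comp]
    rfl
  exists_frame s := by
    obtain ⟨U, hs, hU, e, he⟩ := V.exists_frame s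
    exact ⟨U, hs, hU, e ≫ twistMap hp k hS V, fun T g => twistMap_bijective hp k hS V he g⟩

/-- The iterated relative Frobenius of a line bundle, as a morphism to the twist. -/
noncomputable def toTwist (V : LineBundle S) : V.total ⟶ (V.twist hp k hS).total :=
  twistMap hp k hS V

lemma IsBasis.comp_toTwist {V : LineBundle S} {T : Over S} {b : T ⟶ V.total} (hb : IsBasis b) :
    IsBasis (V := V.twist hp k hS) (b ≫ V.toTwist hp k hS) :=
  fun _ g => twistMap_bijective hp k hS V hb g

lemma smul_comp_toTwist (V : LineBundle S) {T : Over S} (c : Γ(T.left, ⊤)) (x : T ⟶ V.total) :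
    (c • x) ≫ V.toTwist hp k hS = c ^ p ^ k • (x ≫ V.toTwist hp k hS) :=
  smul_comp_twistMap hp k hS V c x

end LineBundle

end

/-! ### Local equations of a finite flat closed subgroup -/

section

open Polynomial

lemma exists_hom_appTop_eq {Y Z : Scheme.{u}} [IsAffine Z] (ψ : Γ(Z, ⊤) →+* Γ(Y, ⊤)) :
    ∃ l : Y ⟶ Z, l.appTop.hom = ψ := by
  refine ⟨Y.toSpecΓ ≫ Spec.map (CommRingCat.ofHom ψ) ≫ Z.isoSpec.inv, ?_⟩
  have h : Y.toSpecΓ ≫ Spec.map (CommRingCat.ofHom ψ) =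
      (Y.toSpecΓ ≫ Spec.map (CommRingCat.ofHom ψ) ≫ Z.isoSpec.inv) ≫ Z.toSpecΓ := by
    simp [← Scheme.isoSpec_hom]
  generalize Y.toSpecΓ ≫ Spec.map (CommRingCat.ofHom ψ) ≫ Z.isoSpec.inv = l at h
  rw [Scheme.toSpecΓ_naturality] at h
  have h2 := congrArg (fun f => (Scheme.ΓSpecIso _).inv ≫ f.appTop) h
  simp only [Scheme.Hom.comp_appTop, ← Scheme.ΓSpecIso_inv_naturality_assoc,
    Scheme.toSpecΓ_appTop, Iso.inv_hom_id, Category.comp_id] at h2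
  exact congrArg CommRingCat.Hom.hom h2.symm

lemma Polynomial.Monic.eq_of_dvd_dvd {R : Type*} [CommRing R] {P Q : R[X]} (hP : P.Monic)
    (hQ : Q.Monic) (h : P ∣ Q) (h' : Q ∣ P) : P = Q := by
  obtain ⟨A, rfl⟩ := h
  obtain ⟨B, hB⟩ := h'
  have hA := hP.of_mul_monic_left hQ
  have hB' : B.Monic := hQ.of_mul_monic_left (hB ▸ hP)
  have hd := congrArg natDegree hB
  rw [hQ.natDegree_mul hB', hP.natDegree_mul hA] at hd
  rw [hA.natDegree_eq_zero.1 (by omega), mul_one]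

variable {S : Scheme.{u}}

namespace LineBundle

variable {V W : LineBundle S}

/-- `Q` is the ring of functions on the preimage of `G` in the chart. This preimage is closed in the
affine line over `T` and is also the base change of `G` to `T`, hence finite and flat. -/
theorem ClosedSubgroup.exists_algebra (G : V.ClosedSubgroup) (hfin : IsFinite G.obj.hom)
    (hflat : Flat G.obj.hom) {T : Over S} [IsAffine T.left] {b : T ⟶ V.total} (hb : IsBasis b) :
    ∃ (Q : Type u) (_ : CommRing Q) (_ : Algebra Γ(T.left, ⊤) Q) (q : Γ(T.left, ⊤)[X] →ₐ[Γ(T.left, ⊤)] Q),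
      Function.Surjective q ∧ Module.Finite Γ(T.left, ⊤) Q ∧ Module.Flat Γ(T.left, ⊤) Q ∧
      ∀ (Y : Over S) (g : Y ⟶ T) (c : Γ(Y.left, ⊤)),
        (∃ y : Y ⟶ G.obj, y ≫ G.incl = c • (g ≫ b)) ↔
          ∀ f, q f = 0 → f.eval₂ g.left.appTop.hom c = 0 := by
  have := G.isClosedImmersion
  let Z := Limits.pullback G.incl.left (param b).left
  let fst : Z ⟶ G.obj.left := Limits.pullback.fst _ _
  let snd : Z ⟶ (lineOver T).left := Limits.pullback.snd _ _
  have hZ : IsPullback fst snd G.incl.left (param b).left := IsPullback.of_hasPullback _ _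
  have hp : IsPullback fst (snd ≫ (lineProj T).left) G.obj.hom T.hom := by
    rw [← Over.w G.incl]
    exact hZ.paste_vert (isPullback_param hb)
  have hsnd : IsClosedImmersion snd := MorphismProperty.of_isPullback hZ this
  have h1 : IsFinite (snd ≫ (lineProj T).left) := MorphismProperty.of_isPullback hp hfin
  have h2 : Flat (snd ≫ (lineProj T).left) := MorphismProperty.of_isPullback hp hflat
  obtain ⟨hZa, hsurj⟩ := IsClosedImmersion.isAffine_surjective_of_isAffine snd
  let φ := (snd ≫ (lineProj T).left).appTop.hom
  let _ : Algebra Γ(T.left, ⊤) Γ(Z, ⊤) := φ.toAlgebra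
  let q : Γ(T.left, ⊤)[X] →ₐ[Γ(T.left, ⊤)] Γ(Z, ⊤) :=
    { snd.appTop.hom.comp (lineEquiv T).toRingHom with
      commutes' := fun r => by
        change snd.appTop.hom (lineEquiv T (C r)) = φ r
        rw [← specOverProj_appTop T C r]
        rfl }
  have hq : Function.Surjective q := hsurj.comp (lineEquiv T).surjective
  refine ⟨Γ(Z, ⊤), inferInstance, inferInstance, q, hq,
    IsFinite.finite_app _ ⊤ (isAffineOpen_top _), Scheme.Hom.flat_appTop _, fun Y g c => ?_⟩
  obtain ⟨k, hk, hk', hk2⟩ := exists_comp_param b g c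
  rw [← hk']
  simp only [← hk2]
  constructor
  · rintro ⟨y, hy⟩ f hf
    have hl := hZ.lift_snd y.left k.left (congrArg (fun f => f.left) hy)
    rw [← hl, Scheme.Hom.comp_appTop]
    change _ = (0 : Γ(Y.left, ⊤))
    exact (congrArg (hZ.lift y.left k.left (congrArg (fun f => f.left) hy)).appTop.hom hf).trans
      (map_zero _)
  · intro h
    obtain ⟨l, hl⟩ := exists_hom_appTop_eq (Y := Y.left) (RingHom.liftOfSurjective q.toRingHom hq
      ⟨k.left.appTop.hom.comp (lineEquiv T).toRingHom, fun f hf => h f hf⟩)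
    have hls : l ≫ snd = k.left := by
      apply ext_of_isAffine
      ext x
      obtain ⟨f, rfl⟩ := (lineEquiv T).surjective x
      change l.appTop.hom (q.toRingHom f) = _
      rw [hl]
      exact RingHom.liftOfRightInverse_comp_apply _ _ _ _ _
    refine ⟨Over.homMk (l ≫ fst) ?_, Over.OverMorphism.ext ?_⟩
    · rw [Category.assoc, ← Over.w G.incl, hZ.w_assoc, ← Category.assoc, hls]
      exact Over.w (k ≫ param b)
    · change (l ≫ fst) ≫ G.incl.left = _
      rw [Category.assoc, hZ.w, ← Category.assoc, hls]
      rfl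


/-- With respect to the section `b` over `T`, the subgroup `G` is the zero locus of the monic
polynomial `P`. -/
def ClosedSubgroup.LocalEq (G : V.ClosedSubgroup) {T : Over S} (b : T ⟶ V.total)
    (P : Γ(T.left, ⊤)[X]) : Prop :=
  P.Monic ∧ ∀ (T' : Over S) (g : T' ⟶ T) (c : Γ(T'.left, ⊤)),
    (∃ y : T' ⟶ G.obj, y ≫ G.incl = c • (g ≫ b)) ↔ P.eval₂ g.left.appTop.hom c = 0

namespace ClosedSubgroup.LocalEq

variable {G : V.ClosedSubgroup} {T : Over S} {b b' : T ⟶ V.total} {P P' : Γ(T.left, ⊤)[X]}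

lemma restrict (h : G.LocalEq b P) {T' : Over S} (g : T' ⟶ T) :
    G.LocalEq (g ≫ b) (P.map g.left.appTop.hom) :=
  ⟨h.1.map _, fun T'' g' c => by
    rw [eval₂_map, ← Category.assoc, h.2 T'' (g' ≫ g) c, Over.comp_left, Scheme.Hom.comp_appTop,
      CommRingCat.hom_comp]⟩

lemma unique [IsAffine T.left] (h : G.LocalEq b P) (h' : G.LocalEq b P') : P = P' := by
  have h1 : P ∣ P' := dvd_of_forall_eval₂ fun T' g c hc => (h'.2 T' g c).1 ((h.2 T' g c).2 hc)
  have h2 : P' ∣ P := dvd_of_forall_eval₂ fun T' g c hc => (h.2 T' g c).1 ((h'.2 T' g c).2 hc)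
  exact h.1.eq_of_dvd_dvd h'.1 h1 h2

/-- Since `c • b = (c u) • b'`, zeros with respect to `b` are zeros with respect to `b'` divided by
`u`. -/
lemma scaleRoots (h : G.LocalEq b' P) (u : Γ(T.left, ⊤)ˣ)
    (hb : b = (u : Γ(T.left, ⊤)) • b') :
    G.LocalEq b (P.scaleRoots (↑u⁻¹ : Γ(T.left, ⊤))) := by
  refine ⟨(monic_scaleRoots_iff _).2 h.1, fun T' g c => ?_⟩
  rw [hb, comp_smul, smul_smul, h.2 T' g]
  have e : c = g.left.appTop.hom (↑u⁻¹ : Γ(T.left, ⊤)) *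
      (c * g.left.appTop.hom (u : Γ(T.left, ⊤))) := by
    rw [mul_left_comm, ← map_mul, Units.inv_mul, map_one, mul_one]
  conv_rhs => rw [e, scaleRoots_eval₂_mul]
  rw [IsUnit.mul_right_eq_zero ((u⁻¹.isUnit.map _).pow _)]

lemma natDegree_eq [IsAffine T.left] (h : G.LocalEq b P) (h' : G.LocalEq b' P')
    (hb : IsBasis b) (hb' : IsBasis b') : P.natDegree = P'.natDegree := by
  obtain ⟨u, hu⟩ := hb.exists_unit hb'
  rw [h.unique (h'.scaleRoots u hu), natDegree_scaleRoots]

/-- The transition between two local equations. -/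
lemma eval₂_eq [IsAffine T.left] (h : G.LocalEq b P) (h' : G.LocalEq b' P')
    {u : Γ(T.left, ⊤)ˣ} (hu : b = (u : Γ(T.left, ⊤)) • b') (c : Γ(T.left, ⊤)) :
    P'.eval (c * u) = u ^ P.natDegree * P.eval c := by
  rw [h.unique (h'.scaleRoots u hu), natDegree_scaleRoots]
  have := scaleRoots_eval₂_mul (p := P') (RingHom.id _) (c * u) (↑u⁻¹ : Γ(T.left, ⊤))
  rw [RingHom.id_apply, mul_left_comm, Units.inv_mul, mul_one] at this
  rw [Polynomial.eval, Polynomial.eval, this, ← mul_assoc, ← Units.val_pow_eq_pow_val, ← Units.val_pow_eq_pow_val,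
    ← Units.val_mul, ← mul_pow, mul_inv_cancel, one_pow, Units.val_one, one_mul]

lemma coeff_zero (h : G.LocalEq b P) : P.coeff 0 = 0 := by
  obtain ⟨z, hz⟩ := G.exists_zero T
  have := (h.2 T (𝟙 T) 0).1 ⟨z, by rw [hz, zero_smul]⟩
  simpa [coeff_zero_eq_eval_zero, ← eval₂_at_zero] using this

/-- Translation by a point of `G` maps `G` into itself. -/
lemma dvd_taylor [IsAffine T.left] (h : G.LocalEq b P) {a : Γ(T.left, ⊤)}
    (ha : P.eval a = 0) : P ∣ taylor a P :=
  dvd_of_forall_eval₂ fun T' g c hc => by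
    obtain ⟨x, hx⟩ := (h.2 T' g c).2 hc
    obtain ⟨y, hy⟩ := (h.2 T' g (g.left.appTop.hom a)).2 (by rw [eval₂_hom, ha, map_zero])
    obtain ⟨z, hz⟩ := G.exists_add T' x y
    have := (h.2 T' g (c + g.left.appTop.hom a)).1 ⟨z, by rw [hz, hx, hy, add_smul]⟩
    rw [taylor_apply, eval₂_comp, eval₂_add, eval₂_X, eval₂_C]
    exact this

/-- Translate by the tautological point of `G`, over the zero scheme of `P`. -/
lemma isAdditive [IsAffine T.left] (h : G.LocalEq b P) {p : ℕ} (hp : p.Prime)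
    (hT : (p : Γ(T.left, ⊤)) = 0) : AdditivePolynomial.IsAdditive P := by
  refine AdditivePolynomial.isAdditive_of_dvd_comp hp hT h.1 h.coeff_zero ?_
  have e : (specOverProj T (AdjoinRoot.of P)).left.appTop.hom =
      (specOverEquiv T (AdjoinRoot.of P)).toRingHom.comp (AdjoinRoot.of P) := by
    ext x; exact specOverProj_appTop T _ x
  have h1 := h.restrict (specOverProj T (AdjoinRoot.of P))
  rw [e] at h1
  generalize specOverEquiv T (AdjoinRoot.of P) = ε at h1
  have hroot : (P.map (ε.toRingHom.comp (AdjoinRoot.of P))).eval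
      (ε.toRingHom (AdjoinRoot.root P)) = 0 := by
    rw [Polynomial.eval_map, ← hom_eval₂, AdjoinRoot.eval₂_root, map_zero]
  have hm := map_dvd (mapRingHom ε.symm.toRingHom) (h1.dvd_taylor hroot)
  have e2 : (P.map (ε.toRingHom.comp (AdjoinRoot.of P))).map ε.symm.toRingHom =
      P.map (AdjoinRoot.of P) := by
    rw [map_map, ← RingHom.comp_assoc]
    congr 1
    ext x
    exact ε.symm_apply_apply _
  rw [coe_mapRingHom, map_taylor, e2] at hm
  have e3 : ε.symm.toRingHom (ε.toRingHom (AdjoinRoot.root P)) = AdjoinRoot.root P :=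
    ε.symm_apply_apply _
  rwa [e3] at hm

end ClosedSubgroup.LocalEq


lemma isUnit_of_basicOpen_eq_top {X : Scheme.{u}} {f : Γ(X, ⊤)} (h : X.basicOpen f = ⊤) :
    IsUnit f := by
  have aux (U : X.Opens) (hU : U = ⊤) (i : U ⟶ ⊤) (hu : IsUnit (X.presheaf.map i.op f)) :
      IsUnit f := by
    subst hU
    rw [Subsingleton.elim i (𝟙 _), op_id, X.presheaf.map_id] at hu
    exact hu
  exact aux _ h _ (X.toRingedSpace.isUnit_res_basicOpen f)

instance {U : S.Opens} [h : IsAffine (U : Scheme.{u})] : IsAffine (opensOver U).left := h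

/-- Around every point, a finite flat closed subgroup is the zero locus of a monic polynomial. -/
theorem ClosedSubgroup.exists_localEq [IsLocallyNoetherian S] (G : V.ClosedSubgroup)
    (hfin : IsFinite G.obj.hom) (hflat : Flat G.obj.hom) (s : S) :
    ∃ U : S.Opens, s ∈ U ∧ IsAffineOpen U ∧ ∃ e : opensOver U ⟶ V.total, IsBasis e ∧
      ∃ P : Γ(U, ⊤)[X], G.LocalEq e P := by
  obtain ⟨U, hs, hU, e, he⟩ := V.exists_frame s
  have : IsAffine (U : Scheme.{u}) := hU
  have : IsNoetherianRing Γ((opensOver U).left, ⊤) :=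
    IsLocallyNoetherian.component_noetherian (X := (U : Scheme.{u})) ⟨⊤, isAffineOpen_top _⟩
  obtain ⟨Q, _, _, q, hq, _, _, h⟩ := G.exists_algebra hfin hflat (T := opensOver U) he
  obtain ⟨r, hr, hP⟩ :=
    AdditivePolynomial.exists_local_monic hq ((U : Scheme.{u}).toSpecΓ ⟨s, hs⟩)
  -- The monic equation exists once `r` is inverted, so the chart is shrunk to the basic open of
  -- `r`.
  let D : (U : Scheme.{u}).Opens := (U : Scheme.{u}).basicOpen r
  have hD : IsAffineOpen D := (isAffineOpen_top (U : Scheme.{u})).basicOpen r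
  let U' : S.Opens := U.ι ''ᵁ D
  have hU' : IsAffineOpen U' := hD.image_of_isOpenImmersion U.ι
  obtain ⟨g⟩ : Nonempty (opensOver U' ⟶ opensOver U) := exists_hom_opensOver fun x => by
    obtain ⟨y, -, hy⟩ := x.2
    change U'.ι x ∈ U
    rw [show U'.ι x = _ from hy.symm]
    exact y.2
  have hu : IsUnit (g.left.appTop.hom r) := by
    refine isUnit_of_basicOpen_eq_top ?_
    rw [← Scheme.preimage_basicOpen_top]
    refine top_le_iff.1 fun x _ => ?_
    obtain ⟨y, hy, hyx⟩ := x.2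
    have hx : U.ι (g.left x) = U'.ι x := congr($(Over.w g) x)
    have : g.left x = y := U.ι.isOpenEmbedding.injective (hx.trans hyx.symm)
    change g.left x ∈ D
    rw [this]
    exact hy
  obtain ⟨P, hPm, hPe⟩ := hP g.left.appTop.hom hu
  refine ⟨U', ⟨⟨s, hs⟩, ?_, rfl⟩, hU', g ≫ e, IsBasis.comp he g, P, hPm, fun T' g' c => ?_⟩
  · change (⟨s, hs⟩ : U) ∈ (U : Scheme.{u}).basicOpen r
    rw [← Scheme.toSpecΓ_preimage_basicOpen]
    exact hr
  · rw [← hPe g'.left.appTop.hom c, ← Category.assoc, h T' (g' ≫ g) c, Over.comp_left,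
      Scheme.Hom.comp_appTop, CommRingCat.hom_comp]

end LineBundle

end

/-! ### Constancy of the degree; factorization through `ξ` -/

section

open Polynomial

variable {S : Scheme.{u}}

lemma exists_affine_le {U U' : S.Opens} {s : S} (h : s ∈ U) (h' : s ∈ U') :
    ∃ W : S.Opens, s ∈ W ∧ IsAffineOpen W ∧ Nonempty (opensOver W ⟶ opensOver U) ∧
      Nonempty (opensOver W ⟶ opensOver U') := by
  obtain ⟨W, hW, hs, hle⟩ := exists_isAffineOpen_mem_and_subset (U := U ⊓ U') ⟨h, h'⟩
  exact ⟨W, hs, hW, exists_hom_opensOver fun x => (hle x.2).1,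
    exists_hom_opensOver fun x => (hle x.2).2⟩

lemma nontrivial_opensOver {U : S.Opens} {s : S} (h : s ∈ U) :
    Nontrivial Γ((opensOver U).left, ⊤) := by
  have : Nonempty (U : Scheme.{u}) := ⟨⟨s, h⟩⟩
  have : Nonempty (⊤ : (U : Scheme.{u}).Opens) := ⟨⟨⟨s, h⟩, trivial⟩⟩
  exact Scheme.component_nontrivial (U : Scheme.{u}) ⊤

lemma appTop_ext_of_isAffine {ι : Type u} {U : ι → S.Opens} (hU : ∀ s, ∃ i, s ∈ U i) {T : Over S}
    {x y : Γ(T.left, ⊤)}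
    (h : ∀ (i : ι) (T' : Over S) (g : T' ⟶ T), (T' ⟶ opensOver (U i)) → IsAffine T'.left →
      g.left.appTop.hom x = g.left.appTop.hom y) : x = y := by
  refine appTop_ext hU fun i T' g k => T'.left.affineCover.ext_elem _ _ fun j => ?_
  let T'' : Over S := Over.mk (T'.left.affineCover.f j ≫ T'.hom)
  let g' : T'' ⟶ T' := Over.homMk (T'.left.affineCover.f j) rfl
  have := h i T'' (g' ≫ g) (g' ≫ k) (inferInstanceAs (IsAffine (T'.left.affineCover.X j)))
  rw [Over.comp_left, Scheme.Hom.comp_appTop] at this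
  exact this

namespace LineBundle

variable {V W : LineBundle S}

/-- The degree of the equation is independent of the frame, hence locally constant. A single degree
is needed in order to use a single Frobenius twist. -/
theorem ClosedSubgroup.exists_localEq_natDegree [IsLocallyNoetherian S] [ConnectedSpace S]
    (G : V.ClosedSubgroup) (hfin : IsFinite G.obj.hom) (hflat : Flat G.obj.hom) :
    ∃ n, ∀ s : S, ∃ U : S.Opens, s ∈ U ∧ IsAffineOpen U ∧ ∃ e : opensOver U ⟶ V.total, IsBasis e ∧
      ∃ P : Γ(U, ⊤)[X], G.LocalEq e P ∧ P.natDegree = n := by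
  choose U hs hU e he P hP using G.exists_localEq hfin hflat
  have hd (s t : S) (hst : t ∈ U s) : (P t).natDegree = (P s).natDegree := by
    obtain ⟨W, hW, hWa, ⟨g⟩, ⟨g'⟩⟩ := exists_affine_le (hs t) hst
    have : IsAffine (W : Scheme.{u}) := hWa
    have := nontrivial_opensOver hW
    have h := ((hP t).restrict g).natDegree_eq ((hP s).restrict g') (IsBasis.comp (he t) g)
      (IsBasis.comp (he s) g')
    rwa [(hP t).1.natDegree_map, (hP s).1.natDegree_map] at h
  have hc : IsLocallyConstant fun s => (P s).natDegree :=
    (IsLocallyConstant.iff_exists_open _).2 fun s => ⟨U s, (U s).2, hs s, fun t ht => hd s t ht⟩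
  obtain ⟨s₀⟩ : Nonempty S := inferInstance
  exact ⟨(P s₀).natDegree, fun s => ⟨U s, hs s, hU s, e s, he s, P s, hP s,
    hc.apply_eq_of_preconnectedSpace s s₀⟩⟩

lemma ClosedSubgroup.hom_ext (G : V.ClosedSubgroup) {T : Over S} {y y' : T ⟶ G.obj}
    (h : y ≫ G.incl = y' ≫ G.incl) : y = y' := by
  have := G.isClosedImmersion
  apply Over.OverMorphism.ext
  rw [← cancel_mono G.incl.left]
  exact congrArg (fun f => f.left) h

lemma LocalExpr.isAdditive {f : V.total ⟶ W.total} (hf : IsGroupHom f) {T : Over S}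
    [IsAffine T.left] {b : T ⟶ V.total} {b' : T ⟶ W.total} (hb' : IsBasis b')
    {P : Γ(T.left, ⊤)[X]} (h : LocalExpr f b b' P) : AdditivePolynomial.IsAdditive P := by
  have key {T' : Over S} (g : T' ⟶ T) (x y : Γ(T'.left, ⊤)) : P.eval₂ g.left.appTop.hom (x + y) =
      P.eval₂ g.left.appTop.hom x + P.eval₂ g.left.appTop.hom y := by
    refine hb'.smul_injective g ?_
    rw [add_smul, ← h, ← h, ← h, add_smul, hf]
  intro R' _ φ x y
  have e : (specOverProj T φ).left.appTop.hom = (specOverEquiv T φ).toRingHom.comp φ := by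
    ext x; exact specOverProj_appTop T φ x
  have h1 := key (specOverProj T φ) ((specOverEquiv T φ).toRingHom x)
    ((specOverEquiv T φ).toRingHom y)
  rw [e, ← map_add, ← hom_eval₂, ← hom_eval₂, ← hom_eval₂, ← map_add] at h1
  exact (specOverEquiv T φ).injective h1

section Cover

variable {ι : Type u} {U : ι → S.Opens}

/-- Local factorizations through `G` agree on overlaps because the inclusion is a monomorphism. -/
lemma ClosedSubgroup.exists_of_cover (hU : ∀ s, ∃ i, s ∈ U i) (G : V.ClosedSubgroup) {T : Over S}
    (x : T ⟶ V.total)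
    (h : ∀ (i : ι) (T' : Over S) (g : T' ⟶ T), (T' ⟶ opensOver (U i)) →
      ∃ y : T' ⟶ G.obj, y ≫ G.incl = g ≫ x) : ∃ y : T ⟶ G.obj, y ≫ G.incl = x := by
  choose y hy using fun i => h i _ (restrictIncl T (U i)) (restrictProj T (U i))
  obtain ⟨z, hz⟩ := exists_glue hU y fun i j T' g g' _ hg => G.hom_ext (by
    rw [Category.assoc, Category.assoc, hy, hy, ← Category.assoc, ← Category.assoc, hg])
  refine ⟨z, over_hom_ext hU fun i T' g k => ?_⟩
  obtain ⟨k', rfl⟩ := exists_hom_restrictOver g k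
  rw [Category.assoc, ← Category.assoc _ z, hz, hy, Category.assoc]

lemma isGroupHom_of_localExpr (hU : ∀ s, ∃ i, s ∈ U i) {e : ∀ i, opensOver (U i) ⟶ V.total}
    (he : ∀ i, IsBasis (e i)) {e' : ∀ i, opensOver (U i) ⟶ W.total} {f : V.total ⟶ W.total}
    {P : ∀ i, Γ(U i, ⊤)[X]} (h : ∀ i, LocalExpr f (e i) (e' i) (P i))
    (hP : ∀ i, AdditivePolynomial.IsAdditive (P i)) : IsGroupHom f := fun T x y => by
  refine over_hom_ext hU fun i T' g k => ?_
  obtain ⟨c, hc⟩ := (he i).exists_smul k (g ≫ x)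
  obtain ⟨d, hd⟩ := (he i).exists_smul k (g ≫ y)
  rw [comp_add, ← Category.assoc, ← Category.assoc, ← Category.assoc, comp_add, hc, hd,
    ← add_smul, h i T' k, h i T' k, h i T' k, hP i, add_smul]

lemma hom_ext_of_localExpr (hU : ∀ s, ∃ i, s ∈ U i) {e : ∀ i, opensOver (U i) ⟶ V.total}
    (he : ∀ i, IsBasis (e i)) {e' : ∀ i, opensOver (U i) ⟶ W.total} {f f' : V.total ⟶ W.total}
    {P : ∀ i, Γ(U i, ⊤)[X]} (h : ∀ i, LocalExpr f (e i) (e' i) (P i))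
    (h' : ∀ i, LocalExpr f' (e i) (e' i) (P i)) : f = f' :=
  over_hom_ext hU fun i T' g k => by
    obtain ⟨c, hc⟩ := (he i).exists_smul k g
    rw [hc, h i T' k, h' i T' k]

variable {e : ∀ i, opensOver (U i) ⟶ V.total}
  {e' : ∀ i, opensOver (U i) ⟶ W.total} {ξ : V.total ⟶ W.total} {P : ∀ i, Γ(U i, ⊤)[X]}

/-- A morphism that is locally given by monic polynomials is an epimorphism. -/
lemma hom_ext_of_comp [∀ i, IsAffine (opensOver (U i)).left] (hU : ∀ s, ∃ i, s ∈ U i) (he' : ∀ i, IsBasis (e' i))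
    (hξ : ∀ i, LocalExpr ξ (e i) (e' i) (P i)) (hP : ∀ i, (P i).Monic)
    (hd : ∀ i, (P i).natDegree ≠ 0) {f f' : W.total ⟶ W.total} (h : ξ ≫ f = ξ ≫ f') : f = f' := by
  choose D hD using fun i => exists_localExpr (T := opensOver (U i)) f (e' i) (he' i)
  choose D' hD' using fun i => exists_localExpr (T := opensOver (U i)) f' (e' i) (he' i)
  have hDD (i) : D i = D' i := by
    have h1 := (hξ i).comp (hD i)
    rw [h] at h1
    exact AdditivePolynomial.comp_injective (hP i) (hd i)
      (LocalExpr.unique (T := opensOver (U i)) (he' i) h1 ((hξ i).comp (hD' i)))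
  exact hom_ext_of_localExpr hU he' hD fun i => hDD i ▸ hD' i

/-- Factorization through a morphism that is locally given by monic polynomials. -/
theorem exists_factor (hU : ∀ s, ∃ i, s ∈ U i) (he : ∀ i, IsBasis (e i))
    (he' : ∀ i, IsBasis (e' i))
    (hξ : ∀ i, LocalExpr ξ (e i) (e' i) (P i)) (hP : ∀ i, (P i).Monic)
    (hd : ∀ i, (P i).natDegree ≠ 0) {F : V.total ⟶ W.total} {D : ∀ i, Γ(U i, ⊤)[X]}
    (hF : ∀ i, LocalExpr F (e i) (e' i) ((D i).comp (P i))) :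
    ∃ f : W.total ⟶ W.total, ξ ≫ f = F ∧ ∀ i, LocalExpr f (e' i) (e' i) (D i) := by
  obtain ⟨f, hf⟩ := exists_hom_of_localExpr hU e' he' e' D
    fun i j T g g' c c' hT hc => by
      rcases subsingleton_or_nontrivial Γ(T.left, ⊤) with hs | hs
      · have := Module.subsingleton Γ(T.left, ⊤) (T ⟶ W.total)
        exact Subsingleton.elim _ _
      obtain ⟨u, hu⟩ := ((he i).comp g).exists_unit ((he j).comp g')
      obtain ⟨v, hv⟩ := ((he' i).comp g).exists_unit ((he' j).comp g')
      have h1 (F : V.total ⟶ W.total) {A : Γ(T.left, ⊤)[X]} {B : Γ(T.left, ⊤)[X]}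
          (hA : LocalExpr F (g ≫ e i) (g ≫ e' i) A) (hB : LocalExpr F (g' ≫ e j) (g' ≫ e' j) B) :
          B.comp (C (u : Γ(T.left, ⊤)) * X) = C (v : Γ(T.left, ⊤)) * A := by
        rw [hu, hv] at hA
        exact LocalExpr.unique ((he' j).comp g') (hB.smul u) hA.mul_left
      have e1 := h1 ξ ((hξ i).restrict g) ((hξ j).restrict g')
      have e2 := h1 F ((hF i).restrict g) ((hF j).restrict g')
      rw [Polynomial.map_comp, Polynomial.map_comp, comp_assoc, e1] at e2
      -- With `P_j(uX) = v P_i`, the transition rule for `D ∘ P` reads `D_j(v P_i) = v D_i(P_i)`;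
      -- the monic `P_i` cancels on the right.
      have e3 : ((D j).map g'.left.appTop.hom).comp (C (v : Γ(T.left, ⊤)) * X) =
          C (v : Γ(T.left, ⊤)) * (D i).map g.left.appTop.hom := by
        refine AdditivePolynomial.comp_injective ((hP i).map g.left.appTop.hom)
          (by rw [(hP i).natDegree_map]; exact hd i) ?_
        simpa [comp_assoc] using e2
      rw [hv, smul_smul] at hc
      have hc' := ((he' j).comp g').smul_injective (𝟙 T) (by simpa using hc)
      have e4 := congrArg (Polynomial.eval c) e3
      rw [hv, smul_smul, ← hc']
      rw [eval_comp, eval_mul, eval_C, eval_X, eval_mul, eval_C, Polynomial.eval_map,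
        Polynomial.eval_map] at e4
      rw [mul_comm c, e4, mul_comm]
  exact ⟨f, hom_ext_of_localExpr hU he (fun i => (hξ i).comp (hf i)) hF, hf⟩

end Cover

end LineBundle

end

/-! ### Drinfeld modules and invariant subgroups in coordinates -/

section

open Polynomial

variable {S : Scheme.{u}}

lemma global_ext {ι : Type u} {U : ι → S.Opens} (hU : ∀ s, ∃ i, s ∈ U i) {x y : Γ(S, ⊤)}
    (h : ∀ i, (U i).ι.appTop.hom x = (U i).ι.appTop.hom y) : x = y :=
  appTop_ext hU (T := Over.mk (𝟙 S)) fun i T' g k => by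
    have e : g.left = k.left ≫ (U i).ι :=
      ((Category.comp_id _).symm.trans (Over.w g)).trans (Over.w k).symm
    rw [e, Scheme.Hom.comp_appTop, CommRingCat.hom_comp, RingHom.comp_apply, RingHom.comp_apply]
    exact congrArg _ (h i)

lemma LineBundle.comp_zero (V : LineBundle S) {T T' : Over S} (g : T' ⟶ T) :
    g ≫ (0 : T ⟶ V.total) = 0 := by
  have h := V.comp_smul g 0 0
  rwa [zero_smul, map_zero, zero_smul] at h

variable {Fq : Type u} [Field Fq] {A : Type u} [CommRing A] [Algebra Fq A]
  {γ : S ⟶ Spec (CommRingCat.of A)}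

lemma appTop_gammaSharp {T T' : Over S} (g : T' ⟶ T) (a : A) :
    g.left.appTop.hom (gammaSharp (T.hom ≫ γ) a) = gammaSharp (T'.hom ≫ γ) a := by
  rw [← Over.w g, Category.assoc]
  rfl

/-- The structure morphism from `𝔽_q` to the global functions of an `A`-scheme. -/
noncomputable def scalarHom (Fq : Type u) [Field Fq] [Algebra Fq A]
    (γ : S ⟶ Spec (CommRingCat.of A)) : Fq →+* Γ(S, ⊤) :=
  (gammaSharp γ).comp (algebraMap Fq A)

variable (Fq) in
lemma natCast_gamma_eq_zero {p : ℕ} [CharP Fq p] (γ : S ⟶ Spec (CommRingCat.of A)) :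
    (p : Γ(S, ⊤)) = 0 := by
  rw [← map_natCast (scalarHom Fq γ), CharP.cast_eq_zero, map_zero]

namespace DrinfeldModule

variable [Fintype Fq]

variable {r : ℕ} (E : DrinfeldModule Fq γ r)

lemma act_zero : E.act 0 = 0 := by
  have h := E.act_add 0 0 _ (𝟙 _)
  rw [Category.id_comp, add_zero] at h
  exact left_eq_add.1 h

variable {E}

lemma localExpr_algebraMap {T : Over S} (b : T ⟶ E.bundle.total) (c : Fq) :
    LineBundle.LocalExpr (E.act (algebraMap Fq A c)) b b
      (C (scalarHom Fq (T.hom ≫ γ) c) * X) := fun T' g d => by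
  rw [E.act_algebraMap, smul_smul, eval₂_mul, eval₂_C, eval₂_X]
  congr 2
  exact (appTop_gammaSharp g _).symm

lemma coeff_one {U : S.Opens} (hU : IsAffineOpen U) {b : opensOver U ⟶ E.bundle.total}
    (hb : LineBundle.IsBasis b) {a : A} {φ : Γ(U, ⊤)[X]}
    (h : LineBundle.LocalExpr (E.act a) b b φ) : φ.coeff 1 = U.ι.appTop.hom (gammaSharp γ a) := by
  -- The derivative condition is only imposed for `a ≠ 0`; for `a = 0` the action is zero.
  by_cases ha : a = 0
  · subst ha
    have : IsAffine (U : Scheme.{u}) := hU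
    have h0 : LineBundle.LocalExpr (E.act 0) b b (0 : Γ((opensOver U).left, ⊤)[X]) :=
      fun T' g c => by rw [act_zero, LineBundle.comp_zero, eval₂_zero, zero_smul]
    rw [LineBundle.LocalExpr.unique (T := opensOver U) hb h h0]
    simp
  · exact E.derivative a ha U hU ⟨b, hb⟩ φ h

/-! Local equations of an invariant subgroup -/

section LocalEq

variable {G : E.bundle.ClosedSubgroup}

/-- Invariance says that `φ_a` carries zeros of `P` to zeros of `P`. -/
lemma dvd_comp_act (hinv : G.IsInvariant) {T : Over S} [IsAffine T.left]
    {b : T ⟶ E.bundle.total} {P : Γ(T.left, ⊤)[X]} (hP : G.LocalEq b P) {a : A}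
    {φ : Γ(T.left, ⊤)[X]} (hφ : LineBundle.LocalExpr (E.act a) b b φ) : P ∣ P.comp φ :=
  LineBundle.dvd_of_forall_eval₂ fun T' g c hc => by
    obtain ⟨y, hy⟩ := (hP.2 T' g c).2 hc
    obtain ⟨z, hz⟩ := hinv a T' y
    rw [eval₂_comp]
    exact (hP.2 T' g _).1 ⟨z, by rw [hz, hy, hφ]⟩

variable {U : S.Opens} {b : opensOver U ⟶ E.bundle.total} {P : Γ(U, ⊤)[X]} {h : ℕ}

lemma coeff_regular (hU : IsAffineOpen U) (hb : LineBundle.IsBasis b) (hP : G.LocalEq b P)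
    (hreg : G.CoeffRegular (Fintype.card Fq) h) :
    P.coeff (Fintype.card Fq ^ h) ∈ nonZeroDivisors (Γ(U, ⊤) : Type u) :=
  hreg U hU ⟨b, hb⟩ P hP

/-- `𝔽_q` acts through `A`, so `G` is stable under it; the regular coefficient sits in degree `q^h`,
where `c^(q^h) = c`. -/
lemma comp_C_mul_X (hU : IsAffineOpen U) (hb : LineBundle.IsBasis b) (hP : G.LocalEq b P)
    (hinv : G.IsInvariant) (hreg : G.CoeffRegular (Fintype.card Fq) h) (c : Fq) :
    P.comp (C (scalarHom Fq (U.ι ≫ γ) c) * X) = C (scalarHom Fq (U.ι ≫ γ) c) * P := by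
  have : IsAffine (U : Scheme.{u}) := hU
  refine AdditivePolynomial.comp_C_mul_X_eq hP.1
    (dvd_comp_act (T := opensOver U) hinv hP (localExpr_algebraMap b c))
    (coeff_regular hU hb hP hreg) ?_
  rw [← map_pow, FiniteField.pow_card_pow]

lemma X_pow_dvd (hU : IsAffineOpen U) (hb : LineBundle.IsBasis b) (hP : G.LocalEq b P)
    (hinv : G.IsInvariant) (hh : G.HasHeight (Fintype.card Fq) h)
    (hreg : G.CoeffRegular (Fintype.card Fq) h) : X ^ Fintype.card Fq ^ h ∣ P := by
  have : IsAffine (U : Scheme.{u}) := hU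
  obtain ⟨p, hchar⟩ := CharP.exists Fq
  have hp : p.Prime := CharP.char_is_prime Fq p
  refine AdditivePolynomial.X_pow_dvd_of_coeff Fintype.one_lt_card
    (AdditivePolynomial.IsAdditive.exists_eq_card_pow (scalarHom Fq (U.ι ≫ γ))
      (LineBundle.ClosedSubgroup.LocalEq.isAdditive (T := opensOver U) hP hp
        (natCast_gamma_eq_zero Fq (U.ι ≫ γ))) (comp_C_mul_X hU hb hP hinv hreg))
    fun i hi => hh.1 i hi U hU ⟨b, hb⟩ P hP

end LocalEq

end DrinfeldModule

end

/-! ### Recovering global properties from local expressions -/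

section

open Polynomial

variable {S : Scheme.{u}}

namespace LineBundle

variable {V W : LineBundle S} {ι : Type u} {U : ι → S.Opens}

/-- A change of frame conjugates the expression by a unit, which leaves the linear coefficient
unchanged. -/
lemma hasDerivativeAtZero_of_localExpr (hU : ∀ s, ∃ i, s ∈ U i)
    {e : ∀ i, opensOver (U i) ⟶ V.total} (he : ∀ i, IsBasis (e i)) {f : V.total ⟶ V.total}
    {D : ∀ i, Γ(U i, ⊤)[X]} (hD : ∀ i, LocalExpr f (e i) (e i) (D i)) {c : Γ(S, ⊤)}
    (hc : ∀ i, (D i).coeff 1 = (U i).ι.appTop.hom c) : HasDerivativeAtZero f c := by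
  intro U₀ hU₀ ε Q hQ
  refine appTop_ext_of_isAffine hU (T := opensOver U₀) fun i T g k hT => ?_
  have hε : IsBasis (T := opensOver U₀) ε.sec := ε.bijective
  have hQ' : LocalExpr (T := opensOver U₀) f ε.sec ε.sec Q := hQ
  obtain ⟨u, hu⟩ := (hε.comp g).exists_unit ((he i).comp k)
  have h1 := hQ'.restrict g
  rw [hu] at h1
  have h2 := congrArg (fun p => p.coeff 1)
    (LocalExpr.unique ((he i).comp k) (((hD i).restrict k).smul (u : Γ(T.left, ⊤))) h1.mul_left)
  simp only [comp_C_mul_X_coeff, coeff_C_mul, coeff_map, pow_one, hc] at h2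
  rw [mul_comm] at h2
  have h3 := u.mul_right_inj.1 h2
  have e1 : g.left ≫ U₀.ι = k.left ≫ (U i).ι := (Over.w g).trans (Over.w k).symm
  have e2 : g.left.appTop.hom (U₀.ι.appTop.hom c) = k.left.appTop.hom ((U i).ι.appTop.hom c) :=
    congr(($e1).appTop.hom c)
  exact h3.symm.trans e2.symm

lemma isKernel_of_localEq (hU : ∀ s, ∃ i, s ∈ U i) {G : V.ClosedSubgroup}
    {e : ∀ i, opensOver (U i) ⟶ V.total} (he : ∀ i, IsBasis (e i))
    {e' : ∀ i, opensOver (U i) ⟶ W.total} (he' : ∀ i, IsBasis (e' i)) {ξ : V.total ⟶ W.total}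
    {P : ∀ i, Γ(U i, ⊤)[X]} (hξ : ∀ i, LocalExpr ξ (e i) (e' i) (P i))
    (hP : ∀ i, G.LocalEq (e i) (P i)) : G.IsKernel ξ := by
  have key (i : ι) {T : Over S} (g : T ⟶ opensOver (U i)) (x : T ⟶ V.total) :
      (∃ y : T ⟶ G.obj, y ≫ G.incl = x) ↔ x ≫ ξ = 0 := by
    obtain ⟨c, rfl⟩ := (he i).exists_smul g x
    rw [(hP i).2 T g c, hξ i T g c]
    constructor
    · intro h
      rw [h, zero_smul]
    · intro h
      exact (he' i).smul_injective g (by rw [h, zero_smul])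
  intro T x
  constructor
  · rintro ⟨y, rfl⟩
    refine over_hom_ext hU fun i T' g k => ?_
    rw [W.comp_zero, ← Category.assoc]
    exact (key i k _).1 ⟨g ≫ y, Category.assoc _ _ _⟩
  · intro h
    refine G.exists_of_cover hU x fun i T' g k => (key i k _).2 ?_
    rw [Category.assoc, h, W.comp_zero]

lemma smul_comp_of_localExpr (hU : ∀ s, ∃ i, s ∈ U i)
    {e : ∀ i, opensOver (U i) ⟶ V.total} (he : ∀ i, IsBasis (e i))
    {e' : ∀ i, opensOver (U i) ⟶ W.total} {f : V.total ⟶ W.total} {P : ∀ i, Γ(U i, ⊤)[X]}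
    (hf : ∀ i, LocalExpr f (e i) (e' i) (P i)) {c : Γ(S, ⊤)}
    (hc : ∀ i, (P i).comp (C ((U i).ι.appTop.hom c) * X) = C ((U i).ι.appTop.hom c) * P i)
    {T : Over S} (x : T ⟶ V.total) :
    (T.hom.appTop.hom c • x) ≫ f = T.hom.appTop.hom c • (x ≫ f) := by
  refine over_hom_ext hU fun i T' g k => ?_
  have e1 : g.left.appTop.hom (T.hom.appTop.hom c) = k.left.appTop.hom ((U i).ι.appTop.hom c) :=
    congr(($((Over.w g).trans (Over.w k).symm)).appTop.hom c)
  obtain ⟨d, hd⟩ := (he i).exists_smul k (g ≫ x)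
  have h1 := congrArg (eval₂ k.left.appTop.hom d) (hc i)
  rw [eval₂_comp, eval₂_mul, eval₂_mul, eval₂_C, eval₂_X] at h1
  rw [comp_smul, ← Category.assoc, ← Category.assoc, comp_smul, hd, e1, smul_smul, hf i T' k,
    hf i T' k, smul_smul, ← h1]

end LineBundle

namespace DrinfeldModule

open LineBundle

variable {Fq : Type u} [Field Fq] [Fintype Fq] {A : Type u} [CommRing A] [Algebra Fq A]
  {γ : S ⟶ Spec (CommRingCat.of A)} {r : ℕ} {E : DrinfeldModule Fq γ r} {W : LineBundle S}
  {ι : Type u} {U : ι → S.Opens}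

/-- An endomorphism that is intertwined with `E.act a` is finite and flat of the same rank. -/
lemma finite_flat_finrank (hU : ∀ s, ∃ i, s ∈ U i) [∀ i, IsAffine (opensOver (U i)).left]
    {e : ∀ i, opensOver (U i) ⟶ E.bundle.total} (he : ∀ i, IsBasis (e i))
    {e' : ∀ i, opensOver (U i) ⟶ W.total} (he' : ∀ i, IsBasis (e' i))
    {P : ∀ i, Γ(U i, ⊤)[X]} (hP : ∀ i, (P i).Monic) (hd : ∀ i, (P i).natDegree ≠ 0)
    {a : A} (ha : a ≠ 0) {φ D : ∀ i, Γ(U i, ⊤)[X]}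
    (hφ : ∀ i, LocalExpr (E.act a) (e i) (e i) (φ i)) {f : W.total ⟶ W.total}
    (hf : ∀ i, LocalExpr f (e' i) (e' i) (D i)) (hD : ∀ i, (P i).comp (φ i) = (D i).comp (P i)) :
    IsFinite f.left ∧ Flat f.left ∧ ∀ y, f.left.finrank y =
      Fintype.card Fq ^ (r * Module.finrank Fq (A ⧸ Ideal.span {a})) := by
  have h1 (i) : (compRingHom (φ i)).Finite :=
    LocalExpr.finite (T := opensOver (U i)) (hφ i) (he i) (he i) (E.finite a ha)
  have h2 (i) : (compRingHom (φ i)).Flat :=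
    LocalExpr.flat (T := opensOver (U i)) (hφ i) (he i) (he i) (E.flat a ha)
  have h3 (i) := AdditivePolynomial.finite_flat_compRingHom_of_comp_eq (hP i) (hd i) (h1 i) (h2 i) (hD i)
  refine ⟨isFinite_of_localExpr hU he' he' hf fun i => (h3 i).1,
    flat_of_localExpr hU he' he' hf fun i => (h3 i).2,
    finrank_of_localExpr hU he' he' hf (fun i => (h3 i).1) (fun i => (h3 i).2) _ fun i x => ?_⟩
  have h4 := LocalExpr.finrank (T := opensOver (U i)) (hφ i) (he i) (he i) (E.finite a ha)
    (E.flat a ha) x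
  rw [E.finrank_eq a ha] at h4
  rw [AdditivePolynomial.finrank_compRingHom (h1 i) (h2 i) x] at h4
  rw [AdditivePolynomial.finrank_compRingHom (h3 i).1 (h3 i).2 x]
  -- Over the residue field degrees multiply, so `deg P · deg φ = deg D · deg P`, and `deg P`
  -- cancels.
  have h5 := congrArg (fun p => (p.map ((algebraMap Γ(U i, ⊤)[X] x.asIdeal.ResidueField).comp C)).natDegree)
    (hD i)
  simp only [Polynomial.map_comp, natDegree_comp, h4, (hP i).natDegree_map] at h5
  rw [mul_comm] at h5
  exact (Nat.eq_of_mul_eq_mul_right (Nat.pos_of_ne_zero (hd i)) h5).symm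

end DrinfeldModule

end

/-! ### The quotient Drinfeld module and the two implications -/

section

open Polynomial LineBundle

variable {S : Scheme.{u}} {Fq : Type u} [Field Fq] [Fintype Fq] {A : Type u} [CommRing A]
  [Algebra Fq A] {γ : S ⟶ Spec (CommRingCat.of A)} {r : ℕ} {E : DrinfeldModule Fq γ r}

namespace DrinfeldModule

/-- The structure of a Drinfeld module on the target `W` of a morphism that is locally given by
the local equations of `G`. -/
theorem exists_isogeny {W : LineBundle S} {ι : Type u} {U : ι → S.Opens}
    (hU : ∀ s, ∃ i, s ∈ U i) [∀ i, IsAffine (opensOver (U i)).left]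
    {e : ∀ i, opensOver (U i) ⟶ E.bundle.total} (he : ∀ i, IsBasis (e i))
    {e' : ∀ i, opensOver (U i) ⟶ W.total} (he' : ∀ i, IsBasis (e' i))
    {G : E.bundle.ClosedSubgroup} {P : ∀ i, Γ(U i, ⊤)[X]} (hP : ∀ i, G.LocalEq (e i) (P i))
    (hd : ∀ i, (P i).natDegree ≠ 0) (hPadd : ∀ i, AdditivePolynomial.IsAdditive (P i))
    (hPlin : ∀ i c, (P i).comp (C (scalarHom Fq ((U i).ι ≫ γ) c) * X) =
      C (scalarHom Fq ((U i).ι ≫ γ) c) * P i)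
    {ξ : E.bundle.total ⟶ W.total} (hξ : ∀ i, LocalExpr ξ (e i) (e' i) (P i))
    (hD : ∀ a i, ∃ φ D : Γ(U i, ⊤)[X], LocalExpr (E.act a) (e i) (e i) φ ∧
      AdditivePolynomial.IsAdditive D ∧ (P i).comp φ = D.comp (P i) ∧
      D.coeff 1 = (U i).ι.appTop.hom (gammaSharp γ a)) :
    ∃ (F : DrinfeldModule Fq γ r) (ξ : Isogeny E F), G.IsKernel ξ.hom := by
  choose φ D hφ hDadd hPD hD1 using hD
  have hm (i) : (P i).Monic := (hP i).1
  have hf (a : A) : ∃ f : W.total ⟶ W.total, ξ ≫ f = E.act a ≫ ξ ∧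
      ∀ i, LocalExpr f (e' i) (e' i) (D a i) :=
    exists_factor hU he he' hξ hm hd fun i => hPD a i ▸ (hφ a i).comp (hξ i)
  choose f hfξ hfD using hf
  -- As `ξ` is an epimorphism for endomorphisms of `W`, each identity between the new actions is
  -- checked after precomposing with `ξ`.
  have hext {g g' : W.total ⟶ W.total} (h : ξ ≫ g = ξ ≫ g') : g = g' :=
    hom_ext_of_comp hU he' hξ hm hd h
  have hξadd : IsGroupHom ξ := isGroupHom_of_localExpr hU he hξ hPadd
  have hmul (a b : A) : f (a * b) = f b ≫ f a := hext (by
    rw [hfξ, E.act_mul, ← Category.assoc, hfξ, Category.assoc, Category.assoc, hfξ])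
  have hadd (a b : A) : f (a + b) = f a + f b := hext (by
    have h1 := E.act_add a b _ (𝟙 _)
    rw [Category.id_comp, Category.id_comp, Category.id_comp] at h1
    rw [hfξ, h1, hξadd, W.comp_add, hfξ, hfξ])
  have hscal (c : Fq) : f (algebraMap Fq A c) =
      gammaSharp (W.total.hom ≫ γ) (algebraMap Fq A c) • 𝟙 W.total := hext (by
    have h1 := E.act_algebraMap c _ (𝟙 _)
    rw [Category.id_comp] at h1
    have h2 := smul_comp_of_localExpr hU he hξ (fun i => hPlin i c) (𝟙 E.bundle.total)
    rw [hfξ, h1, W.comp_smul, appTop_gammaSharp, Category.comp_id]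
    rw [Category.id_comp] at h2
    exact h2)
  have hscal' (c : Fq) (T : Over S) (x : T ⟶ W.total) : x ≫ f (algebraMap Fq A c) =
      gammaSharp (T.hom ≫ γ) (algebraMap Fq A c) • x := by
    rw [hscal, W.comp_smul, appTop_gammaSharp, Category.comp_id]
  have hring (a : A) (ha : a ≠ 0) := finite_flat_finrank hU he he' hm hd ha (hφ a) (hfD a) (hPD a)
  refine ⟨{ rank_pos := E.rank_pos
            bundle := W
            act := f
            isFqLinearHom := fun a =>
              ⟨isGroupHom_of_localExpr hU he' (hfD a) (hDadd a), fun c T x => ?_⟩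
            act_one := hext ?_
            act_mul := hmul
            act_add := fun a b T x => by rw [hadd, W.comp_add]
            act_algebraMap := hscal'
            derivative := fun a _ => hasDerivativeAtZero_of_localExpr hU he' (hfD a) (hD1 a)
            finite := fun a ha => (hring a ha).1
            flat := fun a ha => (hring a ha).2.1
            finrank_eq := fun a ha => (hring a ha).2.2 },
    { hom := ξ
      isGroupHom := hξadd
      finite := isFinite_of_localExpr hU he he' hξ
        fun i => AdditivePolynomial.finite_compRingHom (hm i) (hd i)
      comm := fun a => (hfξ a).symm }, isKernel_of_localEq hU he he' hξ hP⟩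
  -- Scalars act as elements of `A`, so `𝔽_q`-linearity of `f a` is commutativity of `A`.
  · rw [← hscal', ← hscal', Category.assoc, Category.assoc, ← hmul, ← hmul, mul_comm]
  · rw [hfξ, E.act_one, Category.id_comp, Category.comp_id]

/-- If a subgroup `G` of height `h` is the kernel of an isogeny, then `γ a ^ q ^ h = γ a`. -/
theorem gammaSharp_pow_eq [IsLocallyNoetherian S] {G : E.bundle.ClosedSubgroup}
    (hfin : IsFinite G.obj.hom) (hflat : Flat G.obj.hom) (hinv : G.IsInvariant) {h : ℕ}
    (hh : G.HasHeight (Fintype.card Fq) h) (hreg : G.CoeffRegular (Fintype.card Fq) h)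
    {F : DrinfeldModule Fq γ r} (ξ : Isogeny E F) (hξ : G.IsKernel ξ.hom) (a : A) :
    gammaSharp γ a ^ Fintype.card Fq ^ h = gammaSharp γ a := by
  have hchart (s : S) : ∃ U : S.Opens, s ∈ U ∧ U.ι.appTop.hom (gammaSharp γ a ^ Fintype.card Fq ^ h) =
      U.ι.appTop.hom (gammaSharp γ a) := by
    obtain ⟨U₁, hs₁, -, e₁, he₁, P₁, hP₁⟩ := G.exists_localEq hfin hflat s
    obtain ⟨U₂, hs₂, -, e₂, he₂⟩ := F.bundle.exists_frame s
    obtain ⟨U, hs, hU, ⟨g₁⟩, ⟨g₂⟩⟩ := exists_affine_le hs₁ hs₂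
    refine ⟨U, hs, ?_⟩
    have : IsAffine (U : Scheme.{u}) := hU
    have hb := IsBasis.comp he₁ g₁
    have hb' : IsBasis (g₂ ≫ e₂) := IsBasis.comp (V := F.bundle) (b := e₂) he₂ g₂
    have hP := hP₁.restrict g₁
    generalize g₁ ≫ e₁ = b at hb hP
    generalize g₂ ≫ e₂ = b' at hb'
    generalize P₁.map g₁.left.appTop.hom = P at hP
    obtain ⟨Q, hQ⟩ := exists_localExpr ξ.hom b hb'
    obtain ⟨φ, hφ⟩ := exists_localExpr (E.act a) b hb
    obtain ⟨ψ, hψ⟩ := exists_localExpr (F.act a) b' hb'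
    have hiff (T : Over S) (g : T ⟶ opensOver U) (c : Γ(T.left, ⊤)) :
        P.eval₂ g.left.appTop.hom c = 0 ↔ Q.eval₂ g.left.appTop.hom c = 0 := by
      rw [← hP.2 T g c, hξ T, hQ T g c]
      constructor
      · intro h
        exact hb'.smul_injective g (by rw [h, zero_smul])
      · intro h
        rw [h, zero_smul]
    obtain ⟨M, hM⟩ : P ∣ Q := dvd_of_forall_eval₂ fun T g c => (hiff T g c).1
    obtain ⟨N, hN⟩ : Q ∣ P := dvd_of_forall_eval₂ fun T g c => (hiff T g c).2
    -- `M` is a unit but need not be constant when the base is not reduced; only the unit `M(0)`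
    -- enters the lowest coefficient of `Q`.
    have hMN : M * N = 1 := hP.1.isRegular.left (by
      change P * (M * N) = P * 1
      rw [← mul_assoc, ← hM, ← hN, mul_one])
    have hMN0 : M.coeff 0 * N.coeff 0 = 1 := by rw [← mul_coeff_zero, hMN, coeff_one_zero]
    have hXP : (X : Γ((opensOver U).left, ⊤)[X]) ^ Fintype.card Fq ^ h ∣ P :=
      X_pow_dvd hU hb hP hinv hh hreg
    have hPreg : P.coeff (Fintype.card Fq ^ h) ∈ nonZeroDivisors Γ((opensOver U).left, ⊤) :=
      coeff_regular hU hb hP hreg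
    have hcomm : Q.comp φ = ψ.comp Q := by
      have h1 := hφ.comp hQ
      rw [ξ.comm] at h1
      exact h1.unique hb' (hQ.comp hψ)
    have hmain := AdditivePolynomial.coeff_mul_coeff_one_pow (hXP.trans ⟨M, hM⟩)
      (pow_ne_zero h Fintype.card_ne_zero)
      (hφ.isAdditive (E.isFqLinearHom a).1 hb).coeff_zero
      (hψ.isAdditive (F.isFqLinearHom a).1 hb').coeff_zero hcomm
    obtain ⟨x, hx⟩ : ∃ x : Γ((opensOver U).left, ⊤), x = U.ι.appTop.hom (gammaSharp γ a) :=
      ⟨_, rfl⟩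
    rw [coeff_one hU hb hφ, coeff_one hU hb' hψ, ← hx] at hmain
    have hQc : Q.coeff (Fintype.card Fq ^ h) = P.coeff (Fintype.card Fq ^ h) * M.coeff 0 := by
      obtain ⟨P', rfl⟩ := hXP
      have e1 := coeff_X_pow_mul (P' * M) (Fintype.card Fq ^ h) 0
      have e2 := coeff_X_pow_mul P' (Fintype.card Fq ^ h) 0
      rw [zero_add] at e1 e2
      rw [hM, mul_assoc, e1, e2, mul_coeff_zero]
    rw [hQc] at hmain
    rw [map_pow, ← hx]
    refine (mul_cancel_left_mem_nonZeroDivisors hPreg).1 ?_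
    -- Multiplying by `N(0)`, the inverse of `M(0)`, removes the unit factor.
    linear_combination N.coeff 0 * hmain -
      P.coeff (Fintype.card Fq ^ h) * (x ^ Fintype.card Fq ^ h - x) * hMN0
  choose U hs hU using hchart
  exact global_ext (fun s => ⟨s, hs s⟩) hU

/-- If `γ a ^ q ^ h = γ a` for all `a`, a subgroup `G` of height `h` is the kernel of an isogeny. -/
theorem exists_isogeny_of_gammaSharp_pow_eq [IsLocallyNoetherian S] [ConnectedSpace S]
    {G : E.bundle.ClosedSubgroup}
    (hfin : IsFinite G.obj.hom) (hflat : Flat G.obj.hom) (hinv : G.IsInvariant) {h : ℕ}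
    (hh : G.HasHeight (Fintype.card Fq) h) (hreg : G.CoeffRegular (Fintype.card Fq) h)
    (hγ : ∀ a : A, gammaSharp γ a ^ Fintype.card Fq ^ h = gammaSharp γ a) :
    ∃ (F : DrinfeldModule Fq γ r) (ξ : Isogeny E F), G.IsKernel ξ.hom := by
  obtain ⟨p, hchar⟩ := CharP.exists Fq
  have hp : p.Prime := CharP.char_is_prime Fq p
  have hS : (p : Γ(S, ⊤)) = 0 := natCast_gamma_eq_zero Fq γ
  obtain ⟨n, hn⟩ := G.exists_localEq_natDegree hfin hflat
  choose U hs hU e he P hP hPn using hn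
  have hcov : ∀ s, ∃ i, s ∈ U i := fun s => ⟨s, hs s⟩
  have (i : S) : IsAffine (opensOver (U i)).left := hU i
  have hnt (i : S) : Nontrivial Γ((opensOver (U i)).left, ⊤) := nontrivial_opensOver (hs i)
  have hchar (i : S) : (p : Γ((opensOver (U i)).left, ⊤)) = 0 :=
    natCast_gamma_eq_zero Fq ((U i).ι ≫ γ)
  have hPadd (i : S) : AdditivePolynomial.IsAdditive (P i) :=
    ClosedSubgroup.LocalEq.isAdditive (T := opensOver (U i)) (hP i) hp (hchar i)
  obtain ⟨k, rfl⟩ : ∃ k, n = p ^ k := by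
    obtain ⟨s⟩ : Nonempty S := inferInstance
    obtain ⟨k, hk⟩ := AdditivePolynomial.IsAdditive.exists_natDegree_eq_pow
      (R := Γ((opensOver (U s)).left, ⊤)) hp (hchar s) (hPadd s) (hP s).1
    exact ⟨k, (hPn s).symm.trans hk⟩
  -- The images of the frames are frames of the twist. In them `ξ` is to be given by `P i`, and the
  -- compatibility to check is that a change of frame by `u` multiplies both the equation and the
  -- twisted frame by `u^(p^k)`.
  have he' (i : S) : IsBasis (V := E.bundle.twist hp k hS) (e i ≫ E.bundle.toTwist hp k hS) :=
    (he i).comp_toTwist hp k hS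
  obtain ⟨ξ, hξ⟩ := exists_hom_of_localExpr hcov e he
    (fun i => (e i ≫ E.bundle.toTwist hp k hS : opensOver (U i) ⟶ (E.bundle.twist hp k hS).total))
    P fun i j T g g' c c' hT hc => by
      obtain ⟨u, hu⟩ := ((he i).comp g).exists_unit ((he j).comp g')
      rw [← Category.assoc, hu, smul_comp_toTwist, smul_smul, Category.assoc]
      rw [hu, smul_smul] at hc
      have hc' := ((he j).comp g').smul_injective (𝟙 T) (by simpa using hc)
      congr 1
      have h1 := ((hP i).restrict g).eval₂_eq ((hP j).restrict g') hu c
      rcases subsingleton_or_nontrivial Γ(T.left, ⊤) with _ | _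
      · exact Subsingleton.elim _ _
      rw [(hP i).1.natDegree_map, hPn, Polynomial.eval_map, Polynomial.eval_map, hc'] at h1
      rw [h1, mul_comm]
  refine exists_isogeny hcov he he' hP (fun i => ?_) hPadd
    (fun i c => comp_C_mul_X (hU i) (he i) (hP i) hinv hreg c) hξ fun a i => ?_
  · rw [hPn]
    exact pow_ne_zero k hp.ne_zero
  · obtain ⟨φ, hφ⟩ := exists_localExpr (T := opensOver (U i)) (E.act a) (e i) (he i)
    have hφadd := hφ.isAdditive (E.isFqLinearHom a).1 (he i)
    obtain ⟨D, hDadd, hD⟩ := AdditivePolynomial.IsAdditive.exists_eq_comp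
      (R := Γ((opensOver (U i)).left, ⊤)) hp (hchar i) (hP i).1
      (hPadd i) ((hPadd i).comp hφadd) (dvd_comp_act hinv (hP i) hφ)
    refine ⟨φ, D, hφ, hDadd, hD, ?_⟩
    -- The lowest coefficients give `x_h γ(a)^(q^h) = x_h D_1`; the hypothesis replaces the power by
    -- `γ(a)`, and `x_h` is regular.
    have h1 := AdditivePolynomial.coeff_mul_coeff_one_pow (X_pow_dvd (hU i) (he i) (hP i) hinv hh hreg)
      (pow_ne_zero h Fintype.card_ne_zero) hφadd.coeff_zero hDadd.coeff_zero hD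
    rw [coeff_one (hU i) (he i) hφ, ← map_pow, hγ] at h1
    exact ((mul_cancel_left_mem_nonZeroDivisors
      (coeff_regular (hU i) (he i) (hP i) hreg)).1 h1).symm

end DrinfeldModule

end

theorem mainTheorem11 {Fq : Type u} [Field Fq] [Fintype Fq] {A : Type u} [CommRing A]
    [Algebra Fq A] (hA : IsCurveCoordinateRing Fq A)
    {S : Scheme.{u}} [IsLocallyNoetherian S] [ConnectedSpace S]
    (γ : S ⟶ Spec (CommRingCat.of A)) {r : ℕ} (E : DrinfeldModule Fq γ r)
    (G : E.bundle.ClosedSubgroup) (hfin : IsFinite G.obj.hom) (hflat : Flat G.obj.hom)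
    (hinv : G.IsInvariant) (h : ℕ) (hh : G.HasHeight (Fintype.card Fq) h)
    (hreg : G.CoeffRegular (Fintype.card Fq) h) :
    (∃ (F : DrinfeldModule Fq γ r) (ξ : Isogeny E F), G.IsKernel ξ.hom) ↔
      ∀ a : A, gammaSharp γ (a ^ Fintype.card Fq ^ h) = gammaSharp γ a := by
  simp only [map_pow]
  constructor
  · rintro ⟨F, ξ, hξ⟩ a
    exact DrinfeldModule.gammaSharp_pow_eq hfin hflat hinv hh hreg ξ hξ a
  · exact DrinfeldModule.exists_isogeny_of_gammaSharp_pow_eq hfin hflat hinv hh hreg
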